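/- Let $n,m_1,m_2\ge 0$, $m=m_1+m_2$. Let $\alpha,S_0\in\mathbb C^{n\times n}$, $\gamma_1\in\mathbb C^{n\times m_1}$, $\gamma\in\mathbb C^{n\times m_2}$ be admissible, i.e. $S_0=S_0^*$, $$\alpha S_0-S_0\alpha^*=i(\gamma_1\gamma_1^*-\gamma\gamma^*),$$ the spectrum $\sigma(\alpha)$ lies in the closed lower half-plane, and $\operatorname{span}\bigcup_{l=0}^{n-1}\operatorname{Im}\alpha^l\gamma_1=\operatorname{span}\bigcup_{l=0}^{n-1}\operatorname{Im}\alpha^l\gamma=\mathbb C^n$. Assume $\det S_0\neq0$ ($S_0$ need not be positive). Put $$\Lambda(x)=[\,e^{-ix\alpha}\gamma_1\;\; e^{ix\alpha}\gamma\,],\quad S(x)=S_0+\int_0^x\Lambda(t)\Lambda(t)^*dt,\quad v(x)=-2i\gamma_1^*e^{ix\alpha^*}S(x)^{-1}e^{ix\alpha}\gamma ,$$ and consider on $[0,\infty)$ the Dirac type system $$u'(x,\lambda)=i(\lambda j+jV(x))u(x,\lambda),\qquad j=\begin{bmatrix}I_{m_1}&0\\0&-I_{m_2}\end{bmatrix},\quad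 V=\begin{bmatrix}0&v\\v^*&0\end{bmatrix}.$$ A solution is a matrix function of $x\in[0,\infty)$ that satisfies the system at all $x\ge 0$ with $\det S(x)\ne0$ and is meromorphic in $x$ on $(0,\infty)$ (this continues it across the singularities of $v$). For real $\lambda$ let $Y$ ($m\times m_1$) and $Z$ ($m\times m_2$) be the solutions with $$Y(x,\lambda)=e^{ix\lambda}\begin{bmatrix}I_{m_1}\\0\end{bmatrix}+o(1)\ (x\to\infty),\qquad Z(0,\lambda)=\begin{bmatrix}0\\I_{m_2}\end{bmatrix},$$ and let $Y_1,Z_1$ be their upper ($m_1$-row) and $Y_2,Z_2$ their lower ($m_2$-row) blocks. The transmission and reflection coefficients are $$T_L(\lambda)=Y_1(0,\lambda)^{-1},\qquad R_L(\lambda)=Y_2(0,\lambda)Y_1(0,\lambda)^{-1},$$ $$T_R(\lambda)=\Bigl(\lim_{x\to\infty}e^{ix\lambda}Z_2(x,\lambda)\Bigr)^{-1},\qquad R_R(\lambda)=\Bigl(\lim_{x\to\infty}e^{-ix\lambda}Z_1(x,\lambda)\Bigr)\Bigl(\lim_{x\to\infty}e^{ix\lambda}Z_2(x,\lambda)\Bigr)^{-1}.$$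 Theorem. The matrix $R(x)=e^{-ix\alpha}S(x)e^{ix\alpha^*}$ is invertible for all large $x$, and the limit $\varkappa_R=\lim_{x\to\infty}R(x)^{-1}$ exists. Let $\theta=\alpha-i\gamma_1\gamma_1^*S_0^{-1}$. For every $\lambda\in\mathbb R\setminus\sigma(\alpha)$, the matrices $\lambda I_n-\theta$ and $\lambda I_n-\alpha^*$ are invertible, the coefficients $T_L,R_L,T_R,R_R$ are well defined (solutions $Y$ and $Z$ exist, and for every such solution the limits and inverses above exist and give the same values), and $$T_L(\lambda)=I_{m_1}-i\gamma_1^*S_0^{-1}(\lambda I_n-\theta)^{-1}\gamma_1,$$ $$R_L(\lambda)=-i\gamma^*S_0^{-1}(\lambda I_n-\theta)^{-1}\gamma_1,$$ $$T_R(\lambda)=I_{m_2}-i\gamma^*S_0^{-1}(\lambda I_n-\theta)^{-1}(I_n-S_0\varkappa_R)\gamma,$$ $$R_R(\lambda)=-i\gamma_1^*S_0^{-1}(\lambda I_n-\theta)^{-1}(I_n-S_0\varkappa_R)\gamma-i\gamma_1^*(\lambda I_n-\alpha^*)^{-1}\varkappa_R\gamma.$$ -/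

import Mathlib

open scoped Matrix Topology
open Filter

noncomputable section

namespace DiracPE

variable {n m₁ m₂ : ℕ}

/-- The matrix `e ^ (z A)`. -/
def mexp (z : ℂ) (A : Matrix (Fin n) (Fin n) ℂ) : Matrix (Fin n) (Fin n) ℂ :=
  NormedSpace.exp (z • A)

/-- The pair `(α, β)` is full range (controllable):
the images of `α ^ l * β`, `l = 0, …, n - 1`, together span `ℂ ^ n`. -/
def FullRange {k : ℕ} (α : Matrix (Fin n) (Fin n) ℂ) (β : Matrix (Fin n) (Fin k) ℂ) : Prop :=
  (⨆ l : Fin n, LinearMap.range (α ^ (l : ℕ) * β).mulVecLin) = ⊤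

/-- Admissible parameter matrices. -/
structure Admissible (α S₀ : Matrix (Fin n) (Fin n) ℂ) (γ₁ : Matrix (Fin n) (Fin m₁) ℂ)
    (γ : Matrix (Fin n) (Fin m₂) ℂ) : Prop where
  hermitian : S₀.IsHermitian
  identity : α * S₀ - S₀ * αᴴ = Complex.I • (γ₁ * γ₁ᴴ - γ * γᴴ)
  spectrum_le : ∀ μ ∈ spectrum ℂ α, μ.im ≤ 0
  fullRange₁ : FullRange α γ₁
  fullRange : FullRange α γ

/-- `Λ(x) = [e^{-ixα} γ₁, e^{ixα} γ]`. -/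
def Lam (α : Matrix (Fin n) (Fin n) ℂ) (γ₁ : Matrix (Fin n) (Fin m₁) ℂ)
    (γ : Matrix (Fin n) (Fin m₂) ℂ) (x : ℝ) : Matrix (Fin n) (Fin m₁ ⊕ Fin m₂) ℂ :=
  Matrix.fromCols (mexp (-(Complex.I * x)) α * γ₁) (mexp (Complex.I * x) α * γ)

/-- `S(x) = S₀ + ∫₀ˣ Λ(t) Λ(t)^* dt`; the integral is taken entrywise. -/
def SMat (α S₀ : Matrix (Fin n) (Fin n) ℂ) (γ₁ : Matrix (Fin n) (Fin m₁) ℂ)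
    (γ : Matrix (Fin n) (Fin m₂) ℂ) (x : ℝ) : Matrix (Fin n) (Fin n) ℂ :=
  S₀ + Matrix.of fun p q => ∫ t in (0 : ℝ)..x, (Lam α γ₁ γ t * (Lam α γ₁ γ t)ᴴ) p q

/-- The points at which `S(x)` is not invertible. -/
def singularSet (α S₀ : Matrix (Fin n) (Fin n) ℂ) (γ₁ : Matrix (Fin n) (Fin m₁) ℂ)
    (γ : Matrix (Fin n) (Fin m₂) ℂ) : Set ℝ :=
  {x | (SMat α S₀ γ₁ γ x).det = 0}

/-- The potential `v` on the semiaxis is the pseudo-exponential potential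
`v(x) = -2i γ₁^* e^{ixα^*} S(x)^{-1} e^{ixα} γ` determined by an admissible set of parameter
matrices. Nothing is said about `v` at the singular points. -/
structure DeterminedBy (v : ℝ → Matrix (Fin m₁) (Fin m₂) ℂ)
    (α S₀ : Matrix (Fin n) (Fin n) ℂ) (γ₁ : Matrix (Fin n) (Fin m₁) ℂ)
    (γ : Matrix (Fin n) (Fin m₂) ℂ) : Prop where
  admissible : Admissible α S₀ γ₁ γ
  formula : ∀ x : ℝ, 0 ≤ x → x ∉ singularSet α S₀ γ₁ γ →
    v x = (-2 * Complex.I) •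
      (γ₁ᴴ * mexp (Complex.I * x) αᴴ * (SMat α S₀ γ₁ γ x)⁻¹ * mexp (Complex.I * x) α * γ)

/-- `R(x) = e^{-ixα} S(x) e^{ixα^*}`. -/
def RMat (α S₀ : Matrix (Fin n) (Fin n) ℂ) (γ₁ : Matrix (Fin n) (Fin m₁) ℂ)
    (γ : Matrix (Fin n) (Fin m₂) ℂ) (x : ℝ) : Matrix (Fin n) (Fin n) ℂ :=
  mexp (-(Complex.I * x)) α * SMat α S₀ γ₁ γ x * mexp (Complex.I * x) αᴴ

/-- `j = diag(I_{m₁}, -I_{m₂})`. -/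
def jMat (m₁ m₂ : ℕ) : Matrix (Fin m₁ ⊕ Fin m₂) (Fin m₁ ⊕ Fin m₂) ℂ :=
  Matrix.fromBlocks 1 0 0 (-1)

/-- `V = [[0, v], [v^*, 0]]`. -/
def VMat (v : Matrix (Fin m₁) (Fin m₂) ℂ) : Matrix (Fin m₁ ⊕ Fin m₂) (Fin m₁ ⊕ Fin m₂) ℂ :=
  Matrix.fromBlocks 0 v vᴴ 0

/-- A matrix solution on `[0, ∞)` of the Dirac type system `u' = i (lam j + j V(x)) u`, where the
potential is singular on the set `sing`: the equation holds (entrywise, with a one-sided derivative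
at `0`) at all `x ≥ 0` outside `sing`, and the solution is continued across singular points as a
meromorphic function of `x`. -/
structure IsSolution (v : ℝ → Matrix (Fin m₁) (Fin m₂) ℂ) (sing : Set ℝ) (lam : ℝ) {k : ℕ}
    (u : ℝ → Matrix (Fin m₁ ⊕ Fin m₂) (Fin k) ℂ) : Prop where
  meromorphic : ∀ p q, MeromorphicOn (fun x => u x p q) (Set.Ioi 0)
  equation : ∀ x : ℝ, 0 ≤ x → x ∉ sing → ∀ p q,
    HasDerivWithinAt (fun t => u t p q)
      ((Complex.I • (((lam : ℂ) • jMat m₁ m₂ + jMat m₁ m₂ * VMat (v x)) * u x)) p q)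
      (Set.Ici 0) x

/-- The solution `Y` with `Y(x) = e^{ix lam} [I; 0] + o(1)` as `x → ∞`. -/
structure IsY (v : ℝ → Matrix (Fin m₁) (Fin m₂) ℂ) (sing : Set ℝ) (lam : ℝ)
    (Y : ℝ → Matrix (Fin m₁ ⊕ Fin m₂) (Fin m₁) ℂ) : Prop where
  solution : IsSolution v sing lam Y
  asymptotics : Tendsto
    (fun x : ℝ => Y x - Complex.exp (Complex.I * x * lam) • Matrix.fromRows 1 0) atTop (𝓝 0)

/-- The solution `Z` with `Z(0) = [0; I]`. -/
structure IsZ (v : ℝ → Matrix (Fin m₁) (Fin m₂) ℂ) (sing : Set ℝ) (lam : ℝ)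
    (Z : ℝ → Matrix (Fin m₁ ⊕ Fin m₂) (Fin m₂) ℂ) : Prop where
  solution : IsSolution v sing lam Z
  initial : Z 0 = Matrix.fromRows 0 1

/-- The left transmission and reflection coefficients of the system at `lam` are well defined and
equal to `TL = Y₁(0)^{-1}` and `RL = Y₂(0) Y₁(0)^{-1}`: a solution `Y` exists, and each such
solution has an invertible block `Y₁(0)` and gives these values. -/
def HasLeftCoefficients (v : ℝ → Matrix (Fin m₁) (Fin m₂) ℂ) (sing : Set ℝ) (lam : ℝ)
    (TL : Matrix (Fin m₁) (Fin m₁) ℂ) (RL : Matrix (Fin m₂) (Fin m₁) ℂ) : Prop :=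
  (∃ Y, IsY v sing lam Y) ∧
  ∀ Y, IsY v sing lam Y →
    IsUnit (Y 0).toRows₁ ∧
    TL = (Y 0).toRows₁⁻¹ ∧
    RL = (Y 0).toRows₂ * (Y 0).toRows₁⁻¹

/-- The right transmission and reflection coefficients of the system at `lam` are well defined and
equal to `TR = B^{-1}` and `RR = A B^{-1}`, where `A = lim e^{-ix lam} Z₁(x)` and
`B = lim e^{ix lam} Z₂(x)`: a solution `Z` exists, and for each such solution both limits exist,
`B` is invertible and these values result. -/
def HasRightCoefficients (v : ℝ → Matrix (Fin m₁) (Fin m₂) ℂ) (sing : Set ℝ) (lam : ℝ)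
    (TR : Matrix (Fin m₂) (Fin m₂) ℂ) (RR : Matrix (Fin m₁) (Fin m₂) ℂ) : Prop :=
  (∃ Z, IsZ v sing lam Z) ∧
  ∀ Z, IsZ v sing lam Z →
    ∃ (A : Matrix (Fin m₁) (Fin m₂) ℂ) (B : Matrix (Fin m₂) (Fin m₂) ℂ),
      Tendsto (fun x : ℝ => Complex.exp (-(Complex.I * x * lam)) • (Z x).toRows₁) atTop (𝓝 A) ∧
      Tendsto (fun x : ℝ => Complex.exp (Complex.I * x * lam) • (Z x).toRows₂) atTop (𝓝 B) ∧
      IsUnit B ∧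
      TR = B⁻¹ ∧
      RR = A * B⁻¹

/-- `θ = α - i γ₁ γ₁^* S₀^{-1}`. -/
def theta (α S₀ : Matrix (Fin n) (Fin n) ℂ) (γ₁ : Matrix (Fin n) (Fin m₁) ℂ) :
    Matrix (Fin n) (Fin n) ℂ :=
  α - Complex.I • (γ₁ * γ₁ᴴ * S₀⁻¹)

/-- The resolvent `(lam I - A)^{-1}`. -/
def res (lam : ℝ) (A : Matrix (Fin n) (Fin n) ℂ) : Matrix (Fin n) (Fin n) ℂ :=
  ((lam : ℂ) • (1 : Matrix (Fin n) (Fin n) ℂ) - A)⁻¹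

end DiracPE

end

noncomputable section

namespace DiracPE

/-! The system is solved explicitly. The identity `α S₀ - S₀ α^* = i(γ₁γ₁^* - γγ^*)` propagates to
`α S(x) - S(x) α^* = i Λ(x) j Λ(x)^*` (`SMat_identity`). With it, the Darboux matrix `w(x,λ) = I + i
j Λ^* S⁻¹ (λ - α)⁻¹ Λ` carries the free system into the given one: `w e^{ixλj}` is a fundamental
solution wherever `det S(x) ≠ 0` (`hasMatDerivWithinAt_fundamental`), and `w^* j w = j` there
(`darboux_conjTranspose_mul_jMat_mul`). It is meromorphic in `x`, and the identity theorem for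
meromorphic functions shows that every solution is this matrix times a constant, even across the
zeros of `det S` (`eq_fundamental_mul`).

The limit of `w` comes from two congruent forms of `S`. For `Q = e^{ixα} S e^{-ixα^*}` the
derivative is `2 e^{2ixα} γγ^* (e^{2ixα})^*`. Since `σ(α)` lies in the closed lower half-plane and
`γ` has full range, the quadratic form of `Q` grows beyond every bound, uniformly on the unit sphere
(`eventually_le_qf_QMat`); this replaces positivity of `S₀`. Hence `Q⁻¹ → 0`, and `R`, being
congruent to `Q`, is eventually positive definite. Since `R` is nondecreasing, `R⁻¹` eventually
decreases and stays nonnegative, so it has a limit `κ`. The mixed factor `R⁻¹ e^{-2ixα}` tends to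
zero by Cauchy–Schwarz between `R⁻¹` and `Q⁻¹`. Therefore `w → diag(I, D)` with `D = I - iγ^* κ (λ -
α)⁻¹ γ`, and `w^* j w = j` makes `D` unitary.

Consequently `Y(0) = w(0) [I; 0]`, while `Z` corresponds to the constant `w(0)⁻¹ [0; I] = j w(0)^* j
[0; I]`. Both left coefficients follow from the resolvent identity for `α` and `θ`; the right ones
from unitarity of `D` and the relation between `α^* S₀⁻¹` and `S₀⁻¹ θ`
(`inv_mul_gamma_mul_rightTransmission`). -/

/-! ### Entrywise derivatives of matrix functions of a real variable -/

/-- Entrywise derivative of a matrix function of a real variable, within a set. -/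
def HasMatDerivWithinAt {ι κ : Type*} (F : ℝ → Matrix ι κ ℂ) (F' : Matrix ι κ ℂ)
    (s : Set ℝ) (x : ℝ) : Prop :=
  ∀ p q, HasDerivWithinAt (fun t => F t p q) (F' p q) s x

section Calculus

variable {ι κ μ : Type*} {F G : ℝ → Matrix ι κ ℂ} {F' G' : Matrix ι κ ℂ} {s : Set ℝ} {x : ℝ}

theorem HasMatDerivWithinAt.congr_deriv (hF : HasMatDerivWithinAt F F' s x) (h : F' = G') :
    HasMatDerivWithinAt F G' s x := h ▸ hF

theorem HasMatDerivWithinAt.mono {t : Set ℝ} (hF : HasMatDerivWithinAt F F' s x) (h : t ⊆ s) :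
    HasMatDerivWithinAt F F' t x := fun p q => (hF p q).mono h

theorem hasMatDerivWithinAt_const (A : Matrix ι κ ℂ) :
    HasMatDerivWithinAt (fun _ => A) 0 s x := fun _ _ => hasDerivWithinAt_const _ _ _

theorem HasMatDerivWithinAt.add (hF : HasMatDerivWithinAt F F' s x)
    (hG : HasMatDerivWithinAt G G' s x) :
    HasMatDerivWithinAt (fun t => F t + G t) (F' + G') s x :=
  fun p q => (hF p q).fun_add (hG p q)

theorem HasMatDerivWithinAt.sub (hF : HasMatDerivWithinAt F F' s x)
    (hG : HasMatDerivWithinAt G G' s x) :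
    HasMatDerivWithinAt (fun t => F t - G t) (F' - G') s x :=
  fun p q => (hF p q).fun_sub (hG p q)

theorem HasMatDerivWithinAt.const_smul (c : ℂ) (hF : HasMatDerivWithinAt F F' s x) :
    HasMatDerivWithinAt (fun t => c • F t) (c • F') s x :=
  fun p q => (hF p q).const_mul c

theorem HasMatDerivWithinAt.conjTranspose (hF : HasMatDerivWithinAt F F' s x) :
    HasMatDerivWithinAt (fun t => (F t)ᴴ) F'ᴴ s x :=
  fun p q => (hF q p).star

theorem HasMatDerivWithinAt.mul [Fintype κ] {H : ℝ → Matrix κ μ ℂ} {H' : Matrix κ μ ℂ}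
    (hF : HasMatDerivWithinAt F F' s x) (hH : HasMatDerivWithinAt H H' s x) :
    HasMatDerivWithinAt (fun t => F t * H t) (F' * H x + F x * H') s x := by
  intro p q
  have := HasDerivWithinAt.fun_sum (u := Finset.univ)
    (fun k _ => (hF p k).fun_mul (hH k q))
  simpa [Matrix.mul_apply, Finset.sum_add_distrib] using this

theorem HasMatDerivWithinAt.const_mul [Fintype κ] {H : ℝ → Matrix κ μ ℂ} {H' : Matrix κ μ ℂ}
    (A : Matrix ι κ ℂ) (hH : HasMatDerivWithinAt H H' s x) :
    HasMatDerivWithinAt (fun t => A * H t) (A * H') s x :=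
  ((hasMatDerivWithinAt_const A).mul hH).congr_deriv (by simp)

theorem HasMatDerivWithinAt.mul_const [Fintype κ] (hF : HasMatDerivWithinAt F F' s x)
    (A : Matrix κ μ ℂ) :
    HasMatDerivWithinAt (fun t => F t * A) (F' * A) s x :=
  (hF.mul (hasMatDerivWithinAt_const A)).congr_deriv (by simp)

theorem HasMatDerivWithinAt.fromCols {H : ℝ → Matrix ι μ ℂ} {H' : Matrix ι μ ℂ}
    (hF : HasMatDerivWithinAt F F' s x) (hH : HasMatDerivWithinAt H H' s x) :
    HasMatDerivWithinAt (fun t => Matrix.fromCols (F t) (H t)) (Matrix.fromCols F' H') s x := by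
  intro p q
  cases q with
  | inl q => exact hF p q
  | inr q => exact hH p q

theorem HasMatDerivWithinAt.tendsto (hF : HasMatDerivWithinAt F F' s x) :
    Tendsto F (𝓝[s] x) (𝓝 (F x)) :=
  tendsto_pi_nhds.2 fun p => tendsto_pi_nhds.2 fun q => (hF p q).continuousWithinAt

theorem tendsto_matrix_iff {τ : Type*} {l : Filter τ} {H : τ → Matrix ι κ ℂ} {A : Matrix ι κ ℂ} :
    Tendsto H l (𝓝 A) ↔ ∀ p q, Tendsto (fun t => H t p q) l (𝓝 (A p q)) :=
  tendsto_pi_nhds.trans (forall_congr' fun _ => tendsto_pi_nhds)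

theorem hasMatDerivWithinAt_iff_tendsto :
    HasMatDerivWithinAt F F' s x ↔
      Tendsto (fun y => ((y - x : ℝ) : ℂ)⁻¹ • (F y - F x)) (𝓝[s \ {x}] x) (𝓝 F') := by
  rw [tendsto_matrix_iff]
  refine forall_congr' fun p => forall_congr' fun q => ?_
  rw [hasDerivWithinAt_iff_tendsto_slope]
  refine iff_of_eq (congrArg (Tendsto · _ _) ?_)
  ext y
  simp [slope_def_module]

theorem tendsto_matrix_mul [Fintype κ] {τ : Type*} {l : Filter τ} {H : τ → Matrix ι κ ℂ}
    {K : τ → Matrix κ μ ℂ} {A : Matrix ι κ ℂ} {B : Matrix κ μ ℂ}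
    (hH : Tendsto H l (𝓝 A)) (hK : Tendsto K l (𝓝 B)) :
    Tendsto (fun t => H t * K t) l (𝓝 (A * B)) := by
  rw [tendsto_matrix_iff] at *
  intro p q
  simp only [Matrix.mul_apply]
  exact tendsto_finsetSum _ fun k _ => (hH p k).mul (hK k q)

theorem tendsto_matrix_det [Fintype ι] [DecidableEq ι] {τ : Type*} {l : Filter τ}
    {H : τ → Matrix ι ι ℂ} {A : Matrix ι ι ℂ} (hH : Tendsto H l (𝓝 A)) :
    Tendsto (fun t => (H t).det) l (𝓝 A.det) :=
  (continuous_id.matrix_det.tendsto A).comp hH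

theorem tendsto_matrix_conjTranspose {τ : Type*} {l : Filter τ}
    {H : τ → Matrix ι κ ℂ} {A : Matrix ι κ ℂ} (hH : Tendsto H l (𝓝 A)) :
    Tendsto (fun t => (H t)ᴴ) l (𝓝 Aᴴ) :=
  (continuous_id.matrix_conjTranspose.tendsto A).comp hH

theorem tendsto_matrix_inv [Fintype ι] [DecidableEq ι] {τ : Type*} {l : Filter τ}
    {H : τ → Matrix ι ι ℂ} {A : Matrix ι ι ℂ} (hH : Tendsto H l (𝓝 A)) (hA : A.det ≠ 0) :
    Tendsto (fun t => (H t)⁻¹) l (𝓝 A⁻¹) := by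
  simp only [Matrix.inv_def, Ring.inverse_eq_inv']
  exact ((tendsto_matrix_det hH).inv₀ hA).smul
    ((continuous_id.matrix_adjugate.tendsto A).comp hH)

theorem HasMatDerivWithinAt.inv [Fintype ι] [DecidableEq ι] {H : ℝ → Matrix ι ι ℂ}
    {H' : Matrix ι ι ℂ} (hH : HasMatDerivWithinAt H H' s x) (hx : (H x).det ≠ 0) :
    HasMatDerivWithinAt (fun t => (H t)⁻¹) (-((H x)⁻¹ * H' * (H x)⁻¹)) s x := by
  have hle : 𝓝[s \ {x}] x ≤ 𝓝[s] x := nhdsWithin_mono _ Set.sdiff_subset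
  have hev : ∀ᶠ y in 𝓝[s \ {x}] x, (H y).det ≠ 0 :=
    ((tendsto_matrix_det hH.tendsto).mono_left hle).eventually_ne hx
  have h1 := tendsto_matrix_inv (hH.tendsto.mono_left hle) hx
  have h2 := hasMatDerivWithinAt_iff_tendsto.1 hH
  rw [hasMatDerivWithinAt_iff_tendsto]
  -- The difference quotient of the inverse is handled through `H(y)⁻¹ - H(x)⁻¹ = -H(y)⁻¹ (H(y) -
  -- H(x)) H(x)⁻¹`, valid for `y` near `x`.
  refine (tendsto_matrix_mul (tendsto_matrix_mul h1 h2) tendsto_const_nhds).neg.congr' ?_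
  filter_upwards [hev] with y hy
  have e1 := Matrix.nonsing_inv_mul (H y) (isUnit_iff_ne_zero.2 hy)
  have e2 := Matrix.mul_nonsing_inv (H x) (isUnit_iff_ne_zero.2 hx)
  rw [Matrix.mul_smul, Matrix.smul_mul, Matrix.mul_sub, Matrix.sub_mul, e1, Matrix.mul_assoc, e2,
    ← smul_neg]
  simp

theorem eq_of_hasMatDerivWithinAt_zero {b : ℝ} (hab : x ≤ b)
    (hF : ∀ y ∈ Set.Icc x b, HasMatDerivWithinAt F 0 (Set.Icc x b) y) : F b = F x := by
  ext p q
  rcases hab.eq_or_lt with rfl | hlt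
  · rfl
  refine constant_of_derivWithin_zero (f := fun t => F t p q) (a := x) (b := b)
    (fun y hy => (hF y hy p q).differentiableWithinAt) (fun y hy => ?_) b ⟨hab, le_rfl⟩
  exact (hF y (Set.Ico_subset_Icc_self hy) p q).derivWithin
    (uniqueDiffOn_Icc hlt y (Set.Ico_subset_Icc_self hy))

theorem eq_of_hasMatDeriv_zero (hF : ∀ y, HasMatDerivWithinAt F 0 Set.univ y) (a b : ℝ) :
    F a = F b := by
  rcases le_total a b with h | h
  · exact (eq_of_hasMatDerivWithinAt_zero h fun y _ => (hF y).mono (Set.subset_univ _)).symm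
  · exact eq_of_hasMatDerivWithinAt_zero h fun y _ => (hF y).mono (Set.subset_univ _)

/-- The operator norm is installed only locally, to use the exponential of a Banach algebra; the
entrywise conclusion does not depend on a norm. -/
theorem hasMatDerivWithinAt_exp [Fintype ι] [DecidableEq ι] (c : ℂ) (A : Matrix ι ι ℂ) :
    HasMatDerivWithinAt (fun t : ℝ => NormedSpace.exp ((c * t) • A))
      (NormedSpace.exp ((c * x) • A) * (c • A)) s x := by
  let _ : NormedRing (Matrix ι ι ℂ) := Matrix.linftyOpNormedRing
  let _ : NormedAlgebra ℝ (Matrix ι ι ℂ) := Matrix.linftyOpNormedAlgebra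
  intro p q
  have h := hasDerivAt_exp_smul_const (𝕂 := ℝ) (c • A) x
  have e : ∀ t : ℝ, t • c • A = (c * t) • A := fun t => by
    rw [← Complex.coe_smul, smul_smul, mul_comm]
  simp only [e] at h
  let L : Matrix ι ι ℂ →L[ℝ] ℂ := LinearMap.toContinuousLinearMap (Matrix.entryLinearMap ℝ ℂ p q)
  exact (L.hasFDerivAt.comp_hasDerivAt x h).hasDerivWithinAt

theorem analyticAt_exp_entry [Fintype ι] [DecidableEq ι] (A : Matrix ι ι ℂ) (x : ℝ) (p q : ι) :
    AnalyticAt ℝ (fun t : ℝ => NormedSpace.exp ((t : ℂ) • A) p q) x := by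
  let _ : NormedRing (Matrix ι ι ℂ) := Matrix.linftyOpNormedRing
  let _ : NormedAlgebra ℝ (Matrix ι ι ℂ) := Matrix.linftyOpNormedAlgebra
  let L : Matrix ι ι ℂ →L[ℝ] ℂ := LinearMap.toContinuousLinearMap (Matrix.entryLinearMap ℝ ℂ p q)
  let T : ℝ →L[ℝ] Matrix ι ι ℂ := ContinuousLinearMap.toSpanSingleton ℝ A
  have h : AnalyticAt ℝ (fun t : ℝ => L (NormedSpace.exp (T t))) x :=
    (L.analyticAt _).comp ((NormedSpace.exp_analytic (𝕂 := ℝ) (T x)).comp (T.analyticAt x))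
  exact h

end Calculus

/-! ### The one-parameter groups `e^{zA}`. -/

section MExp

variable {n : ℕ} (A : Matrix (Fin n) (Fin n) ℂ)

theorem mexp_zero : mexp 0 A = 1 := by simp [mexp]

theorem mexp_mul_mexp (z w : ℂ) : mexp z A * mexp w A = mexp (z + w) A := by
  rw [mexp, mexp, mexp, add_smul, Matrix.exp_add_of_commute]
  exact (Commute.refl A).smul_left z |>.smul_right w

theorem mexp_mul_mexp_neg (z : ℂ) : mexp z A * mexp (-z) A = 1 := by
  rw [mexp_mul_mexp, add_neg_cancel, mexp_zero]

theorem mexp_neg_mul_mexp (z : ℂ) : mexp (-z) A * mexp z A = 1 := by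
  rw [mexp_mul_mexp, neg_add_cancel, mexp_zero]

theorem mexp_conjTranspose (z : ℂ) : (mexp z A)ᴴ = mexp (star z) Aᴴ := by
  rw [mexp, mexp, ← Matrix.exp_conjTranspose, Matrix.conjTranspose_smul]

theorem mexp_comm (z : ℂ) {B : Matrix (Fin n) (Fin n) ℂ} (h : Commute A B) :
    mexp z A * B = B * mexp z A := by
  have : Commute (z • A) B := h.smul_left z
  open scoped Matrix.Norms.Operator in
  exact (this.exp_left (𝔸 := Matrix (Fin n) (Fin n) ℂ)).eq

theorem hasMatDerivWithinAt_mexp (c : ℂ) {s : Set ℝ} {x : ℝ} :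
    HasMatDerivWithinAt (fun t : ℝ => mexp (c * t) A) (c • (A * mexp (c * x) A)) s x := by
  refine (hasMatDerivWithinAt_exp c A).congr_deriv ?_
  rw [← mexp_comm A _ (Commute.refl A), Matrix.mul_smul]
  rfl

end MExp

/-! ### Meromorphic matrix functions -/

section Meromorphic

variable {ι κ μ : Type*} {x : ℝ}

theorem meromorphicAt_matrix_mul [Fintype κ] {F : ℝ → Matrix ι κ ℂ} {G : ℝ → Matrix κ μ ℂ}
    (hF : ∀ p q, MeromorphicAt (fun t => F t p q) x)
    (hG : ∀ p q, MeromorphicAt (fun t => G t p q) x) (p : ι) (q : μ) :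
    MeromorphicAt (fun t => (F t * G t) p q) x := by
  simp only [Matrix.mul_apply]
  exact MeromorphicAt.fun_sum fun k _ => (hF p k).fun_mul (hG k q)

theorem meromorphicAt_matrix_det [Fintype ι] [DecidableEq ι] {F : ℝ → Matrix ι ι ℂ}
    (hF : ∀ p q, MeromorphicAt (fun t => F t p q) x) :
    MeromorphicAt (fun t => (F t).det) x := by
  simp only [Matrix.det_apply']
  exact MeromorphicAt.fun_sum fun σ _ =>
    (MeromorphicAt.const _ x).fun_mul (MeromorphicAt.fun_prod fun i _ => hF (σ i) i)

/-- Cramer's rule `det⁻¹ • adjugate` also holds for the total inverse at singular matrices, where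
both sides are zero. So no nonvanishing of the determinant is needed, not even near the point. -/
theorem meromorphicAt_matrix_inv [Fintype ι] [DecidableEq ι] {F : ℝ → Matrix ι ι ℂ}
    (hF : ∀ p q, MeromorphicAt (fun t => F t p q) x) (p q : ι) :
    MeromorphicAt (fun t => (F t)⁻¹ p q) x := by
  simp only [Matrix.inv_def, Ring.inverse_eq_inv', Matrix.smul_apply, Matrix.adjugate_apply,
    smul_eq_mul]
  refine (meromorphicAt_matrix_det hF).fun_inv.fun_mul (meromorphicAt_matrix_det fun i k => ?_)
  by_cases h : i = q
  · subst h
    simp [MeromorphicAt.const]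
  · simpa [Matrix.updateRow_ne h] using hF i k

end Meromorphic

/-! ### The matrix functions `S`, `R` and `Q` -/

section Parameters

variable {n m₁ m₂ : ℕ} (α S₀ : Matrix (Fin n) (Fin n) ℂ) (γ₁ : Matrix (Fin n) (Fin m₁) ℂ)
  (γ : Matrix (Fin n) (Fin m₂) ℂ) {s : Set ℝ} {x : ℝ}

theorem hasMatDerivWithinAt_mexp_I :
    HasMatDerivWithinAt (fun t : ℝ => mexp (Complex.I * t) α)
      (Complex.I • (α * mexp (Complex.I * x) α)) s x :=
  hasMatDerivWithinAt_mexp α _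

theorem hasMatDerivWithinAt_mexp_neg_I :
    HasMatDerivWithinAt (fun t : ℝ => mexp (-(Complex.I * t)) α)
      (-(Complex.I • (α * mexp (-(Complex.I * x)) α))) s x := by
  simpa only [neg_mul, neg_smul] using hasMatDerivWithinAt_mexp (x := x) (s := s) α (-Complex.I)

theorem conjTranspose_mexp_I (x : ℝ) :
    (mexp (Complex.I * x) α)ᴴ = mexp (-(Complex.I * x)) αᴴ := by
  rw [mexp_conjTranspose]; simp

theorem conjTranspose_mexp_neg_I (x : ℝ) :
    (mexp (-(Complex.I * x)) α)ᴴ = mexp (Complex.I * x) αᴴ := by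
  rw [mexp_conjTranspose]; simp

theorem Lam_mul_conjTranspose (x : ℝ) :
    Lam α γ₁ γ x * (Lam α γ₁ γ x)ᴴ =
      mexp (-(Complex.I * x)) α * (γ₁ * γ₁ᴴ) * (mexp (-(Complex.I * x)) α)ᴴ +
        mexp (Complex.I * x) α * (γ * γᴴ) * (mexp (Complex.I * x) α)ᴴ := by
  simp only [Lam, Matrix.conjTranspose_fromCols_eq_fromRows_conjTranspose, Matrix.fromCols_mul_fromRows,
    Matrix.conjTranspose_mul, Matrix.mul_assoc]

theorem Lam_mul_jMat (x : ℝ) :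
    Lam α γ₁ γ x * jMat m₁ m₂ =
      Matrix.fromCols (mexp (-(Complex.I * x)) α * γ₁) (-(mexp (Complex.I * x) α * γ)) := by
  simp [Lam, jMat, Matrix.fromCols_mul_fromBlocks]

theorem Lam_mul_jMat_mul_conjTranspose (x : ℝ) :
    Lam α γ₁ γ x * jMat m₁ m₂ * (Lam α γ₁ γ x)ᴴ =
      mexp (-(Complex.I * x)) α * (γ₁ * γ₁ᴴ) * (mexp (-(Complex.I * x)) α)ᴴ -
        mexp (Complex.I * x) α * (γ * γᴴ) * (mexp (Complex.I * x) α)ᴴ := by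
  rw [Lam_mul_jMat]
  simp only [Lam, Matrix.conjTranspose_fromCols_eq_fromRows_conjTranspose, Matrix.fromCols_mul_fromRows,
    Matrix.conjTranspose_mul, Matrix.mul_assoc, Matrix.neg_mul, sub_eq_add_neg]

theorem hasMatDerivWithinAt_Lam :
    HasMatDerivWithinAt (Lam α γ₁ γ)
      (-(Complex.I • (α * (Lam α γ₁ γ x * jMat m₁ m₂)))) s x := by
  refine (((hasMatDerivWithinAt_mexp_neg_I α).mul_const γ₁).fromCols
    ((hasMatDerivWithinAt_mexp_I α).mul_const γ)).congr_deriv ?_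
  rw [Lam_mul_jMat, Matrix.mul_fromCols]
  ext p (q | q) <;> simp [Matrix.mul_assoc]

theorem hasMatDerivWithinAt_SMat :
    HasMatDerivWithinAt (SMat α S₀ γ₁ γ) (Lam α γ₁ γ x * (Lam α γ₁ γ x)ᴴ) s x := by
  intro p q
  have hc : Continuous fun t => (Lam α γ₁ γ t * (Lam α γ₁ γ t)ᴴ) p q := by
    refine continuous_iff_continuousAt.2 fun t => ?_
    have h := hasMatDerivWithinAt_Lam (s := Set.univ) (x := t) α γ₁ γ
    exact continuousWithinAt_univ _ _ |>.1 ((h.mul h.conjTranspose) p q).continuousWithinAt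
  exact ((hc.integral_hasStrictDerivAt 0 x).hasDerivAt.const_add (S₀ p q)).hasDerivWithinAt

theorem SMat_zero : SMat α S₀ γ₁ γ 0 = S₀ := by
  ext p q
  simp [SMat]

variable {α S₀ γ₁ γ}

theorem SMat_isHermitian (hS₀ : S₀.IsHermitian) (x : ℝ) : (SMat α S₀ γ₁ γ x).IsHermitian := by
  have h : ∀ y, HasMatDerivWithinAt
      (fun t => (SMat α S₀ γ₁ γ t)ᴴ - SMat α S₀ γ₁ γ t) 0 Set.univ y := fun y => by
    refine ((hasMatDerivWithinAt_SMat α S₀ γ₁ γ).conjTranspose.sub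
      (hasMatDerivWithinAt_SMat α S₀ γ₁ γ)).congr_deriv ?_
    simp
  have := eq_of_hasMatDeriv_zero h x 0
  simp only [SMat_zero, hS₀.eq, sub_self] at this
  exact sub_eq_zero.1 this

/-- Since `Λ' = -iαΛj` and `j² = 1`, the derivative of `iΛjΛ^*` is `αΛΛ^* - ΛΛ^*α^*`, which is also
the derivative of the left side because `S' = ΛΛ^*`. The two sides agree at `0` by admissibility. -/
theorem SMat_identity (h : α * S₀ - S₀ * αᴴ = Complex.I • (γ₁ * γ₁ᴴ - γ * γᴴ)) (x : ℝ) :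
    α * SMat α S₀ γ₁ γ x - SMat α S₀ γ₁ γ x * αᴴ =
      Complex.I • (Lam α γ₁ γ x * jMat m₁ m₂ * (Lam α γ₁ γ x)ᴴ) := by
  have hd : ∀ y, HasMatDerivWithinAt
      (fun t => α * SMat α S₀ γ₁ γ t - SMat α S₀ γ₁ γ t * αᴴ -
        Complex.I • (Lam α γ₁ γ t * jMat m₁ m₂ * (Lam α γ₁ γ t)ᴴ)) 0 Set.univ y := fun y => by
    have hS := hasMatDerivWithinAt_SMat (s := Set.univ) (x := y) α S₀ γ₁ γ
    have hL := hasMatDerivWithinAt_Lam (s := Set.univ) (x := y) α γ₁ γ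
    refine (((hS.const_mul α).sub (hS.mul_const αᴴ)).sub
      (((hL.mul_const _).mul hL.conjTranspose).const_smul Complex.I)).congr_deriv ?_
    have hj : jMat m₁ m₂ * jMat m₁ m₂ = 1 := by simp [jMat, Matrix.fromBlocks_multiply]
    have hj' : (jMat m₁ m₂)ᴴ = jMat m₁ m₂ := by simp [jMat, Matrix.fromBlocks_conjTranspose]
    have hj2 : ∀ B : Matrix (Fin m₁ ⊕ Fin m₂) (Fin n) ℂ, jMat m₁ m₂ * (jMat m₁ m₂ * B) = B :=
      fun B => by rw [← Matrix.mul_assoc, hj, Matrix.one_mul]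
    simp only [Matrix.conjTranspose_neg, Matrix.conjTranspose_smul, Matrix.conjTranspose_mul, hj',
      Matrix.mul_assoc, Matrix.neg_mul, Matrix.smul_mul, Matrix.mul_smul, hj2,
      smul_add, smul_neg, smul_smul, Complex.star_def, Complex.conj_I, Complex.I_mul_I, neg_smul,
      one_smul, neg_neg]
    abel
  have := eq_of_hasMatDeriv_zero hd x 0
  beta_reduce at this
  rw [SMat_zero, Lam_mul_jMat_mul_conjTranspose α γ₁ γ 0, h] at this
  simp only [Complex.ofReal_zero, mul_zero, neg_zero, mexp_zero, Matrix.conjTranspose_one,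
    Matrix.one_mul, Matrix.mul_one, sub_self] at this
  exact sub_eq_zero.1 this

end Parameters

/-! ### The congruent forms `Q` and `R` of `S`: derivatives and meromorphy. -/

section Conjugated

variable {n m₁ m₂ : ℕ} {α S₀ : Matrix (Fin n) (Fin n) ℂ} {γ₁ : Matrix (Fin n) (Fin m₁) ℂ}
  {γ : Matrix (Fin n) (Fin m₂) ℂ} {s : Set ℝ} {x : ℝ}

variable (α S₀ γ₁ γ) in
/-- `Q(x) = e^{ixα} S(x) e^{-ixα^*}`. -/
def QMat (x : ℝ) : Matrix (Fin n) (Fin n) ℂ :=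
  mexp (Complex.I * x) α * SMat α S₀ γ₁ γ x * (mexp (Complex.I * x) α)ᴴ

theorem RMat_eq (x : ℝ) : RMat α S₀ γ₁ γ x =
    mexp (-(Complex.I * x)) α * SMat α S₀ γ₁ γ x * (mexp (-(Complex.I * x)) α)ᴴ := by
  rw [RMat, conjTranspose_mexp_neg_I]

theorem QMat_zero : QMat α S₀ γ₁ γ 0 = S₀ := by
  simp [QMat, SMat_zero, mexp_zero]

theorem QMat_isHermitian (hS₀ : S₀.IsHermitian) (x : ℝ) : (QMat α S₀ γ₁ γ x).IsHermitian :=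
  Matrix.isHermitian_mul_mul_conjTranspose _ (SMat_isHermitian hS₀ x)

theorem mexp_I_sq (x : ℝ) : mexp (Complex.I * x) α * mexp (Complex.I * x) α =
    mexp (2 * (Complex.I * x)) α := by rw [mexp_mul_mexp, two_mul]

theorem mexp_neg_I_sq (x : ℝ) : mexp (-(Complex.I * x)) α * mexp (-(Complex.I * x)) α =
    mexp (-(2 * (Complex.I * x))) α := by rw [mexp_mul_mexp, two_mul, neg_add]

/-- Differentiating the exponential factors produces `i(αS - Sα^*) = -ΛjΛ^*`; added to `S' = ΛΛ^*`
this cancels the `γ₁` part and doubles the `γ` part. -/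
theorem hasMatDerivWithinAt_QMat
    (h : α * S₀ - S₀ * αᴴ = Complex.I • (γ₁ * γ₁ᴴ - γ * γᴴ)) :
    HasMatDerivWithinAt (QMat α S₀ γ₁ γ)
      ((2 : ℂ) • (mexp (2 * (Complex.I * x)) α * (γ * γᴴ) * (mexp (2 * (Complex.I * x)) α)ᴴ))
      s x := by
  have he := hasMatDerivWithinAt_mexp_I (s := s) (x := x) α
  refine ((he.mul (hasMatDerivWithinAt_SMat α S₀ γ₁ γ)).mul he.conjTranspose).congr_deriv ?_
  have hid := SMat_identity h x
  rw [← mexp_I_sq]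
  set E := mexp (Complex.I * x) α
  set S := SMat α S₀ γ₁ γ x
  have hE : α * E = E * α := (mexp_comm α _ (Commute.refl α)).symm
  have hsub : α * S = S * αᴴ +
    Complex.I • (Lam α γ₁ γ x * jMat m₁ m₂ * (Lam α γ₁ γ x)ᴴ) := by rw [← hid]; abel
  rw [hE]
  have e2 := Lam_mul_jMat_mul_conjTranspose α γ₁ γ x
  have e3 := Lam_mul_conjTranspose α γ₁ γ x
  -- Pushing `α` through `S` leaves `i S α^*`, which will cancel against the derivative of the
  -- right-hand exponential.
  have : Complex.I • (E * α) * S + E * (Lam α γ₁ γ x * (Lam α γ₁ γ x)ᴴ) =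
      E * (Complex.I • (S * αᴴ) + (2 : ℂ) • (E * (γ * γᴴ) * Eᴴ)) := by
    rw [Matrix.smul_mul, Matrix.mul_assoc, hsub, e2, e3, ← Matrix.mul_smul, ← Matrix.mul_add]
    congr 1
    rw [smul_add, smul_smul, Complex.I_mul_I]
    module
  rw [this]
  simp only [Matrix.conjTranspose_smul, Matrix.conjTranspose_mul, Matrix.mul_add, Matrix.add_mul,
    Matrix.mul_assoc, Matrix.smul_mul, Matrix.mul_smul, Complex.star_def, Complex.conj_I, neg_smul,
    Matrix.mul_neg]
  abel

/-- Same computation with the opposite sign in the exponentials, so that now the `γ` part cancels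
and the `γ₁` part is doubled. -/
theorem hasMatDerivWithinAt_RMat
    (h : α * S₀ - S₀ * αᴴ = Complex.I • (γ₁ * γ₁ᴴ - γ * γᴴ)) :
    HasMatDerivWithinAt (RMat α S₀ γ₁ γ)
      ((2 : ℂ) • (mexp (-(2 * (Complex.I * x))) α * (γ₁ * γ₁ᴴ) *
        (mexp (-(2 * (Complex.I * x))) α)ᴴ)) s x := by
  rw [funext (RMat_eq (α := α) (S₀ := S₀) (γ₁ := γ₁) (γ := γ))]
  have he := hasMatDerivWithinAt_mexp_neg_I (s := s) (x := x) α
  refine ((he.mul (hasMatDerivWithinAt_SMat α S₀ γ₁ γ)).mul he.conjTranspose).congr_deriv ?_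
  have hid := SMat_identity h x
  rw [← mexp_neg_I_sq]
  set E := mexp (-(Complex.I * x)) α
  set S := SMat α S₀ γ₁ γ x
  have hE : α * E = E * α := (mexp_comm α _ (Commute.refl α)).symm
  have hsub : α * S = S * αᴴ +
    Complex.I • (Lam α γ₁ γ x * jMat m₁ m₂ * (Lam α γ₁ γ x)ᴴ) := by rw [← hid]; abel
  rw [hE]
  have e2 := Lam_mul_jMat_mul_conjTranspose α γ₁ γ x
  have e3 := Lam_mul_conjTranspose α γ₁ γ x
  have : -(Complex.I • (E * α)) * S + E * (Lam α γ₁ γ x * (Lam α γ₁ γ x)ᴴ) =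
      E * (-(Complex.I • (S * αᴴ)) + (2 : ℂ) • (E * (γ₁ * γ₁ᴴ) * Eᴴ)) := by
    rw [Matrix.neg_mul, Matrix.smul_mul, Matrix.mul_assoc, hsub, e2, e3, ← Matrix.mul_smul,
      ← Matrix.mul_neg, ← Matrix.mul_add]
    congr 1
    rw [smul_add, smul_smul, Complex.I_mul_I]
    module
  rw [this]
  simp only [Matrix.conjTranspose_smul, Matrix.conjTranspose_mul, Matrix.mul_add, Matrix.add_mul,
    Matrix.mul_assoc, Matrix.smul_mul, Matrix.mul_smul, Complex.star_def, Complex.conj_I, neg_smul,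
    Matrix.conjTranspose_neg, neg_neg, Matrix.mul_neg, Matrix.neg_mul]
  abel

theorem analyticAt_mexp_entry (A : Matrix (Fin n) (Fin n) ℂ) (c : ℂ) (x : ℝ) (p q : Fin n) :
    AnalyticAt ℝ (fun t : ℝ => mexp (c * t) A p q) x := by
  have h := analyticAt_exp_entry (c • A) x p q
  simp only [smul_smul] at h
  simpa only [mexp, mul_comm c] using h

theorem meromorphicAt_mexp_entry (A : Matrix (Fin n) (Fin n) ℂ) (c : ℂ) (x : ℝ) (p q : Fin n) :
    MeromorphicAt (fun t : ℝ => mexp (c * t) A p q) x :=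
  (analyticAt_mexp_entry A c x p q).meromorphicAt

/-- The row `[e^{-2ixα}, R(x) e^{-2ixα^*}]` solves a linear equation with constant coefficients. -/
theorem fromCols_RMat_eq (h : α * S₀ - S₀ * αᴴ = Complex.I • (γ₁ * γ₁ᴴ - γ * γᴴ)) (x : ℝ) :
    Matrix.fromCols (mexp (-(2 * (Complex.I * x))) α)
        (RMat α S₀ γ₁ γ x * mexp (-(2 * (Complex.I * x))) αᴴ) =
      Matrix.fromCols (1 : Matrix (Fin n) (Fin n) ℂ) S₀ * NormedSpace.exp ((x : ℂ) • Matrix.fromBlocks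
        (-(2 * Complex.I) • α) ((2 : ℂ) • (γ₁ * γ₁ᴴ)) 0 (-(2 * Complex.I) • αᴴ)) := by
  set M := Matrix.fromBlocks
        (-(2 * Complex.I) • α) ((2 : ℂ) • (γ₁ * γ₁ᴴ)) 0 (-(2 * Complex.I) • αᴴ) with hM
  set F : ℝ → Matrix (Fin n) (Fin n ⊕ Fin n) ℂ := fun x =>
    Matrix.fromCols (mexp (-(2 * (Complex.I * x))) α)
        (RMat α S₀ γ₁ γ x * mexp (-(2 * (Complex.I * x))) αᴴ) with hF
  have hexp : ∀ (A : Matrix (Fin n) (Fin n) ℂ) (y : ℝ), HasMatDerivWithinAt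
      (fun t : ℝ => mexp (-(2 * (Complex.I * t))) A)
      (-(2 * Complex.I) • (A * mexp (-(2 * (Complex.I * y))) A)) Set.univ y := fun A y => by
    have := hasMatDerivWithinAt_mexp (s := Set.univ) (x := y) A (-(2 * Complex.I))
    simpa only [neg_mul, mul_assoc] using this
  have hF' : ∀ y, HasMatDerivWithinAt F (F y * M) Set.univ y := fun y => by
    refine ((hexp α y).fromCols ((hasMatDerivWithinAt_RMat h).mul (hexp αᴴ y))).congr_deriv ?_
    have hinv : (mexp (-(2 * (Complex.I * y))) α)ᴴ * mexp (-(2 * (Complex.I * y))) αᴴ = 1 := by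
      rw [mexp_conjTranspose, mexp_mul_mexp]
      simp [mexp_zero]
    rw [hF, hM, Matrix.fromCols_mul_fromBlocks, ← mexp_comm α _ (Commute.refl α),
      ← mexp_comm αᴴ _ (Commute.refl αᴴ)]
    simp only [Matrix.smul_mul, Matrix.mul_smul, Matrix.mul_assoc, hinv, Matrix.mul_one,
      Matrix.mul_zero, add_zero]
  -- Because `F' = F M`, the product `F(x) e^{-xM}` is constant, hence equal to `F(0)`.
  have hd : ∀ y, HasMatDerivWithinAt
      (fun t => F t * NormedSpace.exp ((-1 * (t : ℂ)) • M)) 0 Set.univ y := fun y => by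
    refine ((hF' y).mul (hasMatDerivWithinAt_exp (-1) M)).congr_deriv ?_
    have hc : NormedSpace.exp ((-1 * (y : ℂ)) • M) * M = M * NormedSpace.exp ((-1 * (y : ℂ)) • M) := by
      have : Commute ((-1 * (y : ℂ)) • M) M := (Commute.refl M).smul_left _
      open scoped Matrix.Norms.Operator in
      exact (this.exp_left (𝔸 := Matrix (Fin n ⊕ Fin n) (Fin n ⊕ Fin n) ℂ)).eq
    rw [Matrix.mul_smul, hc, Matrix.mul_smul, Matrix.mul_assoc, neg_one_smul, add_neg_cancel]
  have h0 := eq_of_hasMatDeriv_zero hd x 0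
  have hinv : NormedSpace.exp ((-1 * (x : ℂ)) • M) * NormedSpace.exp ((x : ℂ) • M) = 1 := by
    rw [← Matrix.exp_add_of_commute _ _ ((Commute.refl M).smul_left _ |>.smul_right _)]
    simp
  have hF0 : F 0 = Matrix.fromCols (1 : Matrix (Fin n) (Fin n) ℂ) S₀ := by
    simp [hF, mexp_zero, RMat, SMat_zero]
  calc F x = F x * NormedSpace.exp ((-1 * (x : ℂ)) • M) * NormedSpace.exp ((x : ℂ) • M) := by
        rw [Matrix.mul_assoc, hinv, Matrix.mul_one]
    _ = _ := by
        rw [h0, hF0]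
        simp only [Complex.ofReal_zero, mul_zero, zero_smul, NormedSpace.exp_zero, Matrix.mul_one]

/-- Up to invertible exponential factors `S` is the second block of `[I, S₀] e^{xM}`, which exhibits
the integral as an analytic function of `x`. -/
theorem meromorphicAt_SMat (h : α * S₀ - S₀ * αᴴ = Complex.I • (γ₁ * γ₁ᴴ - γ * γᴴ)) (x : ℝ)
    (p q : Fin n) : MeromorphicAt (fun t => SMat α S₀ γ₁ γ t p q) x := by
  have hX : ∀ p q, MeromorphicAt
      (fun t : ℝ => (RMat α S₀ γ₁ γ t * mexp (-(2 * (Complex.I * t))) αᴴ) p q) x := fun p q => by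
    have h1 := meromorphicAt_matrix_mul (F := fun _ => Matrix.fromCols (1 : Matrix (Fin n) (Fin n) ℂ) S₀)
      (fun p q => MeromorphicAt.const _ x)
      (fun p q => (analyticAt_exp_entry (Matrix.fromBlocks
        (-(2 * Complex.I) • α) ((2 : ℂ) • (γ₁ * γ₁ᴴ)) 0 (-(2 * Complex.I) • αᴴ)) x
          p q).meromorphicAt) p (Sum.inr q)
    refine h1.congr (Eventually.of_forall fun t => ?_)
    beta_reduce
    rw [← fromCols_RMat_eq (γ := γ) h]
    rfl
  have hS : ∀ t : ℝ, SMat α S₀ γ₁ γ t = mexp (Complex.I * t) α *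
      (RMat α S₀ γ₁ γ t * mexp (-(2 * (Complex.I * t))) αᴴ) * mexp (Complex.I * t) αᴴ := fun t => by
    rw [RMat]
    have e2 : mexp (Complex.I * t) αᴴ * (mexp (-(2 * (Complex.I * t))) αᴴ *
        mexp (Complex.I * t) αᴴ) = 1 := by
      rw [mexp_mul_mexp, mexp_mul_mexp]
      ring_nf
      exact mexp_zero _
    simp only [Matrix.mul_assoc, e2, Matrix.mul_one]
    rw [← Matrix.mul_assoc, mexp_mul_mexp_neg, Matrix.one_mul]
  simp only [hS]
  exact meromorphicAt_matrix_mul (meromorphicAt_matrix_mul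
    (meromorphicAt_mexp_entry α _ x) hX) (meromorphicAt_mexp_entry αᴴ _ x) p q

end Conjugated

/-! ### Real quadratic forms of complex matrices -/

section QuadForm

variable {ι κ : Type*} [Fintype ι] [Fintype κ]

/-- The real part of the quadratic form `f^* M f`. -/
def qf (M : Matrix ι ι ℂ) (f : ι → ℂ) : ℝ := (star f ⬝ᵥ M *ᵥ f).re

theorem qf_add_matrix (M N : Matrix ι ι ℂ) (f : ι → ℂ) : qf (M + N) f = qf M f + qf N f := by
  simp [qf, Matrix.add_mulVec, dotProduct_add]

theorem qf_sub_matrix (M N : Matrix ι ι ℂ) (f : ι → ℂ) : qf (M - N) f = qf M f - qf N f := by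
  simp [qf, Matrix.sub_mulVec, dotProduct_sub]

theorem qf_neg_matrix (M : Matrix ι ι ℂ) (f : ι → ℂ) : qf (-M) f = -qf M f := by
  simp [qf, Matrix.neg_mulVec]

theorem qf_ofReal_smul_matrix (c : ℝ) (M : Matrix ι ι ℂ) (f : ι → ℂ) :
    qf ((c : ℂ) • M) f = c * qf M f := by
  simp [qf, Matrix.smul_mulVec, dotProduct_smul]

theorem qf_conj (A : Matrix ι κ ℂ) (M : Matrix κ κ ℂ) (f : ι → ℂ) :
    qf (A * M * Aᴴ) f = qf M (Aᴴ *ᵥ f) := by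
  simp only [qf, Matrix.star_mulVec, Matrix.conjTranspose_conjTranspose, ← Matrix.dotProduct_mulVec,
    Matrix.mulVec_mulVec, Matrix.mul_assoc]

theorem qf_smul (M : Matrix ι ι ℂ) (c : ℂ) (f : ι → ℂ) :
    qf M (c • f) = Complex.normSq c * qf M f := by
  have : star c * c = (Complex.normSq c : ℂ) := by
    rw [Complex.normSq_eq_conj_mul_self]; rfl
  rw [qf, Matrix.mulVec_smul, star_smul, smul_dotProduct, dotProduct_smul, smul_smul, this, qf,
    smul_eq_mul, Complex.re_ofReal_mul]

/-- The parallelogram law; it makes the vectors with bounded form closed under addition. -/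
theorem qf_add_add_qf_sub (M : Matrix ι ι ℂ) (f g : ι → ℂ) :
    qf M (f + g) + qf M (f - g) = 2 * qf M f + 2 * qf M g := by
  simp only [qf, Matrix.mulVec_add, Matrix.mulVec_sub, star_add, star_sub, add_dotProduct,
    sub_dotProduct, dotProduct_add, dotProduct_sub, Complex.add_re, Complex.sub_re]
  ring

theorem qf_one [DecidableEq ι] (f : ι → ℂ) : qf 1 f = ∑ i, Complex.normSq (f i) := by
  rw [qf, Matrix.one_mulVec, dotProduct, Complex.re_sum]
  refine Finset.sum_congr rfl fun i _ => ?_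
  simp [Complex.normSq_apply]

theorem qf_one_nonneg [DecidableEq ι] (f : ι → ℂ) : 0 ≤ qf 1 f := by
  rw [qf_one]
  exact Finset.sum_nonneg fun i _ => Complex.normSq_nonneg _

theorem qf_one_eq_zero [DecidableEq ι] {f : ι → ℂ} (h : qf 1 f = 0) : f = 0 := by
  rw [qf_one, Finset.sum_eq_zero_iff_of_nonneg fun i _ => Complex.normSq_nonneg _] at h
  exact funext fun i => Complex.normSq_eq_zero.1 (h i (Finset.mem_univ i))

theorem qf_mul_conjTranspose [DecidableEq κ] (A : Matrix ι κ ℂ) (f : ι → ℂ) :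
    qf (A * Aᴴ) f = qf 1 (Aᴴ *ᵥ f) := by
  rw [← qf_conj, Matrix.mul_one]

theorem qf_mul_conjTranspose_nonneg [DecidableEq κ] (A : Matrix ι κ ℂ) (f : ι → ℂ) :
    0 ≤ qf (A * Aᴴ) f := by
  rw [qf_mul_conjTranspose]
  exact qf_one_nonneg _

theorem qf_eq_sum (M : Matrix ι ι ℂ) (f : ι → ℂ) :
    qf M f = ∑ p, ∑ q, (M p q * (star (f p) * f q)).re := by
  simp only [qf, dotProduct, Matrix.mulVec, Complex.re_sum, Finset.mul_sum, Pi.star_apply]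
  refine Finset.sum_congr rfl fun p _ => Finset.sum_congr rfl fun q _ => ?_
  congr 1
  ring

theorem HasMatDerivWithinAt.qf {F : ℝ → Matrix ι ι ℂ} {F' : Matrix ι ι ℂ} {s : Set ℝ} {x : ℝ}
    (hF : HasMatDerivWithinAt F F' s x) (f : ι → ℂ) :
    HasDerivWithinAt (fun t => qf (F t) f) (qf F' f) s x := by
  simp only [qf_eq_sum]
  refine HasDerivWithinAt.fun_sum fun p _ => HasDerivWithinAt.fun_sum fun q _ => ?_
  exact (Complex.reCLM.hasFDerivAt.comp_hasDerivWithinAt x ((hF p q).mul_const _))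

theorem continuous_qf (M : Matrix ι ι ℂ) : Continuous (qf M) := by
  simp only [funext (qf_eq_sum M)]
  fun_prop

end QuadForm

/-! ### The exponential on eigenvectors. -/

section Exp

variable {n : ℕ} (A : Matrix (Fin n) (Fin n) ℂ)

theorem mexp_mulVec_of_mulVec_eq_zero {f : Fin n → ℂ} (h : A *ᵥ f = 0) (z : ℂ) :
    mexp z A *ᵥ f = f := by
  have hd : ∀ y, HasMatDerivWithinAt (fun t : ℝ => mexp (z * t) A * Matrix.replicateCol Unit f) 0
      Set.univ y := fun y => by
    refine ((hasMatDerivWithinAt_mexp A z).mul_const _).congr_deriv ?_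
    rw [← mexp_comm A _ (Commute.refl A), Matrix.smul_mul, Matrix.mul_assoc,
      ← Matrix.replicateCol_mulVec, h]
    ext
    simp
  have := eq_of_hasMatDeriv_zero hd 1 0
  simp only [Complex.ofReal_one, mul_one, Complex.ofReal_zero, mul_zero, mexp_zero,
    ← Matrix.replicateCol_mulVec] at this
  rw [Matrix.one_mulVec] at this
  exact Matrix.replicateCol_injective this

/-- Splitting `zA = zμ I + z(A - μ)` into commuting summands reduces to a vector in the kernel of
the second one, which its exponential fixes. -/
theorem mexp_mulVec_of_mulVec_eq_smul {f : Fin n → ℂ} {μ : ℂ} (h : A *ᵥ f = μ • f) (z : ℂ) :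
    mexp z A *ᵥ f = Complex.exp (z * μ) • f := by
  have e : z • A = (z * μ) • (1 : Matrix (Fin n) (Fin n) ℂ) + z • (A - μ • 1) := by
    rw [smul_sub, smul_smul]; abel
  have h1 : NormedSpace.exp ((z * μ) • (1 : Matrix (Fin n) (Fin n) ℂ)) =
      Complex.exp (z * μ) • (1 : Matrix (Fin n) (Fin n) ℂ) := by
    rw [Matrix.smul_one_eq_diagonal, Matrix.exp_diagonal, Matrix.smul_one_eq_diagonal]
    congr 1
    ext i
    rw [Pi.coe_exp, Complex.exp_eq_exp_ℂ]
  have h2 : mexp z (A - μ • 1) *ᵥ f = f :=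
    mexp_mulVec_of_mulVec_eq_zero _ (by simp [Matrix.sub_mulVec, h, Matrix.smul_mulVec]) z
  rw [mexp, e, Matrix.exp_add_of_commute _ _ ((Commute.one_left _).smul_left _), h1,
    ← Matrix.mulVec_mulVec]
  change _ *ᵥ (mexp z (A - μ • 1) *ᵥ f) = _
  rw [h2, Matrix.smul_mulVec, Matrix.one_mulVec]

end Exp

/-! ### Controllability and eigenvectors. -/

section FullRangeLemma

variable {n k : ℕ} {α : Matrix (Fin n) (Fin n) ℂ} {β : Matrix (Fin n) (Fin k) ℂ}

/-- An eigenvector of `α^*` that is orthogonal to the image of `β` vanishes (Hautus test). -/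
theorem FullRange.eq_zero_of_mulVec_eq_smul (h : FullRange α β) {f : Fin n → ℂ} {μ : ℂ}
    (hα : αᴴ *ᵥ f = μ • f) (hβ : βᴴ *ᵥ f = 0) : f = 0 := by
  have hpow : ∀ l : ℕ, (αᴴ ^ l) *ᵥ f = μ ^ l • f := fun l => by
    induction l with
    | zero => simp
    | succ l ih =>
      rw [pow_succ', ← Matrix.mulVec_mulVec, ih, Matrix.mulVec_smul, hα, smul_smul, pow_succ]
  -- For an eigenvector, `f^* α^l β` is a multiple of `f^* β = 0`, so `f` is orthogonal to the span
  -- of all these images, which contains `f` itself.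
  have hle : ∀ y ∈ (⊤ : Submodule ℂ (Fin n → ℂ)), star f ⬝ᵥ y = 0 := by
    intro y hy
    rw [← h] at hy
    induction hy using Submodule.iSup_induction' with
    | mem l y hy =>
      obtain ⟨g, rfl⟩ := hy
      have e : star f ᵥ* (α ^ (l : ℕ) * β) = 0 := by
        rw [← star_star (star f ᵥ* (α ^ (l : ℕ) * β)), Matrix.star_vecMul, star_star,
          Matrix.conjTranspose_mul, Matrix.conjTranspose_pow, ← Matrix.mulVec_mulVec, hpow,
          Matrix.mulVec_smul, hβ, smul_zero, star_zero]
      rw [Matrix.mulVecLin_apply, Matrix.dotProduct_mulVec, e, zero_dotProduct]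
    | zero => exact dotProduct_zero _
    | add y z _ _ hy hz => rw [dotProduct_add, hy, hz, add_zero]
  exact qf_one_eq_zero (by rw [qf, Matrix.one_mulVec, hle f trivial, Complex.zero_re])

end FullRangeLemma

/-! ### Cauchy–Schwarz and polarization for Hermitian matrices. -/

section CauchySchwarz

variable {ι : Type*} [Fintype ι]

/-- A nonnegative Hermitian form is a possibly degenerate inner product, and Cauchy–Schwarz holds
for those. -/
theorem norm_dotProduct_mulVec_sq_le {M : Matrix ι ι ℂ} (hM : M.IsHermitian)
    (h : ∀ f, 0 ≤ qf M f) (f g : ι → ℂ) : ‖star f ⬝ᵥ M *ᵥ g‖ ^ 2 ≤ qf M f * qf M g := by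
  let c : PreInnerProductSpace.Core ℂ (ι → ℂ) :=
    { inner := fun x y => star x ⬝ᵥ M *ᵥ y
      conj_inner_symm := fun x y => by
        rw [starRingEnd_apply, Matrix.star_dotProduct, star_star, Matrix.star_mulVec, hM.eq,
          ← Matrix.dotProduct_mulVec]
      re_inner_nonneg := h
      add_left := fun x y z => by rw [star_add, add_dotProduct]
      smul_left := fun x y r => by rw [star_smul, smul_dotProduct]; rfl }
  have h1 := InnerProductSpace.Core.inner_mul_inner_self_le (𝕜 := ℂ) (F := ι → ℂ) f g
  rw [InnerProductSpace.Core.norm_inner_symm g f, ← sq] at h1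
  exact h1

theorem qf_single [DecidableEq ι] (M : Matrix ι ι ℂ) (p : ι) :
    qf M (Pi.single p 1) = (M p p).re := by
  simp [qf]

/-- Cauchy–Schwarz for the vectors `e_p` and `B e_q`. Applied with `M = R⁻¹` and `B = e^{-2ixα}`,
for which `B^* M B = Q⁻¹`. -/
theorem norm_mul_apply_sq_le [DecidableEq ι] {M : Matrix ι ι ℂ} (hM : M.IsHermitian)
    (h : ∀ f, 0 ≤ qf M f) (B : Matrix ι ι ℂ) (p q : ι) :
    ‖(M * B) p q‖ ^ 2 ≤ (M p p).re * ((Bᴴ * M * B) q q).re := by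
  have h1 := norm_dotProduct_mulVec_sq_le hM h (Pi.single p 1) (B *ᵥ Pi.single q 1)
  have h2 := qf_conj Bᴴ M (Pi.single q 1)
  rw [Matrix.conjTranspose_conjTranspose] at h2
  rw [← h2, qf_single, qf_single, Matrix.mulVec_mulVec] at h1
  simpa using h1

/-- Polarization of the entries of a Hermitian matrix. -/
theorem IsHermitian_apply_eq [DecidableEq ι] {M : Matrix ι ι ℂ} (hM : M.IsHermitian) (p q : ι) :
    M p q = ((qf M (Pi.single p 1 + Pi.single q 1) - qf M (Pi.single p 1 - Pi.single q 1)) / 4 : ℝ) -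
      ((qf M (Pi.single p 1 + Complex.I • Pi.single q 1) -
        qf M (Pi.single p 1 - Complex.I • Pi.single q 1)) / 4 : ℝ) * Complex.I := by
  have h := hM.apply p q
  have e : ∀ c : ℂ, qf M (Pi.single p 1 + c • Pi.single q 1) -
      qf M (Pi.single p 1 - c • Pi.single q 1) = 2 * (c * M p q + star c * M q p).re := fun c => by
    simp only [qf, star_add, star_sub, Matrix.mulVec_add, Matrix.mulVec_sub, add_dotProduct,
      sub_dotProduct, dotProduct_add, dotProduct_sub, star_smul, smul_dotProduct, Matrix.mulVec_smul,
      dotProduct_smul, Complex.add_re, Complex.sub_re]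
    simp
    ring
  have e1 := e 1
  rw [one_smul] at e1
  rw [e1, e Complex.I, ← h]
  apply Complex.ext <;> simp <;> ring

end CauchySchwarz

/-! ### Unbounded growth of the quadratic form of `Q`. -/

section Growth

variable {n m₁ m₂ : ℕ} {α S₀ : Matrix (Fin n) (Fin n) ℂ} {γ₁ : Matrix (Fin n) (Fin m₁) ℂ}
  {γ : Matrix (Fin n) (Fin m₂) ℂ}

theorem hasDerivAt_qf_QMat (h : Admissible α S₀ γ₁ γ) (f : Fin n → ℂ) (x : ℝ) :
    HasDerivAt (fun t => qf (QMat α S₀ γ₁ γ t) f)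
      (2 * qf 1 (γᴴ *ᵥ ((mexp (2 * (Complex.I * x)) α)ᴴ *ᵥ f))) x := by
  have h1 := (hasMatDerivWithinAt_QMat (s := Set.univ) (x := x) h.identity).qf f
  rw [hasDerivWithinAt_univ] at h1
  refine h1.congr_deriv ?_
  symm
  rw [← qf_mul_conjTranspose, ← qf_conj, ← qf_ofReal_smul_matrix]
  simp

theorem monotone_qf_QMat (h : Admissible α S₀ γ₁ γ) (f : Fin n → ℂ) :
    Monotone fun t => qf (QMat α S₀ γ₁ γ t) f :=
  monotone_of_deriv_nonneg (fun x => (hasDerivAt_qf_QMat h f x).differentiableAt) fun x => by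
    rw [(hasDerivAt_qf_QMat h f x).deriv]
    have := qf_one_nonneg (γᴴ *ᵥ ((mexp (2 * (Complex.I * x)) α)ᴴ *ᵥ f))
    positivity

/-- By the group law for `e^{2ixα}`, a shift of the argument multiplies `Q'` by fixed factors on
both sides. Both sides thus have the same derivative in `x`, and they vanish at `x = 0`. -/
theorem QMat_add (h : Admissible α S₀ γ₁ γ) (s x : ℝ) :
    QMat α S₀ γ₁ γ (x + s) - QMat α S₀ γ₁ γ s =
      mexp (2 * (Complex.I * s)) α * (QMat α S₀ γ₁ γ x - S₀) *
        (mexp (2 * (Complex.I * s)) α)ᴴ := by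
  have hd : ∀ y, HasMatDerivWithinAt (fun t => QMat α S₀ γ₁ γ (t + s) -
      mexp (2 * (Complex.I * s)) α * QMat α S₀ γ₁ γ t *
        (mexp (2 * (Complex.I * s)) α)ᴴ) 0 Set.univ y := fun y => by
    have h1 : HasMatDerivWithinAt (fun t => QMat α S₀ γ₁ γ (t + s)) _ Set.univ y := fun p q => by
      have := hasMatDerivWithinAt_QMat (s := Set.univ) (x := y + s) h.identity p q
      rw [hasDerivWithinAt_univ] at this
      exact (this.comp_add_const y s).hasDerivWithinAt
    refine (h1.sub (((hasMatDerivWithinAt_QMat (s := Set.univ) h.identity).const_mul _).mul_const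
      _)).congr_deriv ?_
    have e : mexp (2 * (Complex.I * (y + s : ℝ))) α =
        mexp (2 * (Complex.I * s)) α * mexp (2 * (Complex.I * y)) α := by
      rw [mexp_mul_mexp]
      congr 1
      push_cast
      ring
    simp only [e, Matrix.conjTranspose_mul, Matrix.mul_smul, Matrix.smul_mul, Matrix.mul_assoc,
      sub_self]
  have := eq_of_hasMatDeriv_zero hd x 0
  simp only [zero_add, QMat_zero] at this
  rw [Matrix.mul_sub, Matrix.sub_mul, sub_eq_sub_iff_sub_eq_sub]
  exact this

variable (α S₀ γ₁ γ) in
/-- The vectors along which the quadratic form of `Q(x)` stays bounded on `[0, ∞)`. -/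
def boundedVectors (h : Admissible α S₀ γ₁ γ) : Submodule ℂ (Fin n → ℂ) where
  carrier := {f | ∃ C, ∀ x, 0 ≤ x → qf (QMat α S₀ γ₁ γ x - S₀) f ≤ C}
  add_mem' := by
    rintro f g ⟨C, hC⟩ ⟨D, hD⟩
    refine ⟨2 * C + 2 * D, fun x hx => ?_⟩
    have h1 := qf_add_add_qf_sub (QMat α S₀ γ₁ γ x - S₀) f g
    have h2 : 0 ≤ qf (QMat α S₀ γ₁ γ x - S₀) (f - g) := by
      rw [qf_sub_matrix, sub_nonneg]
      have := monotone_qf_QMat h (f - g) hx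
      simpa only [QMat_zero] using this
    linarith [hC x hx, hD x hx]
  zero_mem' := ⟨0, fun x _ => by simp [qf]⟩
  smul_mem' := by
    rintro c f ⟨C, hC⟩
    refine ⟨Complex.normSq c * C, fun x hx => ?_⟩
    rw [qf_smul]
    exact mul_le_mul_of_nonneg_left (hC x hx) (Complex.normSq_nonneg c)

/-- By `QMat_add`, the form of `Q(x) - S₀` at the moved vector equals that of `Q(x + s) - Q(s)` at
`f`. -/
theorem mexp_mem_boundedVectors (h : Admissible α S₀ γ₁ γ) {f : Fin n → ℂ}
    (hf : f ∈ boundedVectors α S₀ γ₁ γ h) {s : ℝ} (hs : 0 ≤ s) :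
    (mexp (2 * (Complex.I * s)) α)ᴴ *ᵥ f ∈ boundedVectors α S₀ γ₁ γ h := by
  obtain ⟨C, hC⟩ := hf
  refine ⟨C - qf (QMat α S₀ γ₁ γ s - S₀) f, fun x hx => ?_⟩
  rw [← qf_conj, ← QMat_add h]
  have := hC (x + s) (add_nonneg hx hs)
  rw [qf_sub_matrix] at this ⊢
  rw [qf_sub_matrix]
  linarith

/-- A subspace of a finite-dimensional space is closed, so invariance under the semigroup
`(e^{2isα})^*`, `s ≥ 0`, passes to its generator, a nonzero multiple of `α^*`. -/
theorem mulVec_mem_boundedVectors (h : Admissible α S₀ γ₁ γ) {f : Fin n → ℂ}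
    (hf : f ∈ boundedVectors α S₀ γ₁ γ h) : αᴴ *ᵥ f ∈ boundedVectors α S₀ γ₁ γ h := by
  set N := boundedVectors α S₀ γ₁ γ h
  have hd : HasMatDerivWithinAt (fun t : ℝ => (mexp (2 * (Complex.I * t)) α)ᴴ *
      Matrix.replicateCol Unit f) (((2 * Complex.I) • α)ᴴ * Matrix.replicateCol Unit f)
      (Set.Ici 0) 0 := by
    have h1 := hasMatDerivWithinAt_mexp (s := Set.Ici 0) (x := 0) α (2 * Complex.I)
    simp only [mul_assoc] at h1
    refine (h1.conjTranspose.mul_const _).congr_deriv ?_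
    simp [mexp_zero]
  have hlim := hasMatDerivWithinAt_iff_tendsto.1 hd
  have hmem : (((2 * Complex.I) • α)ᴴ *ᵥ f) ∈ N := by
    have hcl : IsClosed (N : Set (Fin n → ℂ)) := N.closed_of_finiteDimensional
    have hset : (Set.Ici (0 : ℝ)) \ {0} = Set.Ioi 0 := Set.Ici_sdiff_left
    rw [hset] at hlim
    have hlim2 : Tendsto (fun y : ℝ => ((y - 0 : ℝ) : ℂ)⁻¹ •
        ((mexp (2 * (Complex.I * y)) α)ᴴ *ᵥ f - (mexp (2 * (Complex.I * (0 : ℝ))) α)ᴴ *ᵥ f))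
        (𝓝[>] 0) (𝓝 (((2 * Complex.I) • α)ᴴ *ᵥ f)) := by
      rw [tendsto_pi_nhds]
      intro p
      exact tendsto_matrix_iff.1 hlim p ()
    refine hcl.mem_of_tendsto hlim2 ?_
    filter_upwards [self_mem_nhdsWithin] with y hy
    exact N.smul_mem _ (N.sub_mem (mexp_mem_boundedVectors h hf (le_of_lt hy))
      (mexp_mem_boundedVectors h hf le_rfl))
  have := N.smul_mem ((star (2 * Complex.I))⁻¹) hmem
  rwa [Matrix.conjTranspose_smul, Matrix.smul_mulVec, smul_smul, inv_mul_cancel₀, one_smul] at this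
  simp

theorem mem_spectrum_of_mulVec_eq_smul {A : Matrix (Fin n) (Fin n) ℂ} {f : Fin n → ℂ} {μ : ℂ}
    (hf : f ≠ 0) (h : A *ᵥ f = μ • f) : μ ∈ spectrum ℂ A := by
  rw [spectrum.mem_iff]
  intro hu
  apply hf
  obtain ⟨B, -, hB⟩ := isUnit_iff_exists.1 hu
  have e : (algebraMap ℂ (Matrix (Fin n) (Fin n) ℂ) μ - A) *ᵥ f = 0 := by
    rw [Algebra.algebraMap_eq_smul_one, Matrix.sub_mulVec, Matrix.smul_mulVec, Matrix.one_mulVec, h,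
      sub_self]
  rw [← Matrix.one_mulVec f, ← hB, ← Matrix.mulVec_mulVec, e, Matrix.mulVec_zero]

theorem boundedVectors_eigenvector_eq_zero (h : Admissible α S₀ γ₁ γ) {f : Fin n → ℂ}
    (hf : f ∈ boundedVectors α S₀ γ₁ γ h) {μ : ℂ} (hμ : αᴴ *ᵥ f = μ • f) : f = 0 := by
  by_contra hf0
  have him : 0 ≤ μ.im := by
    have h1 : μ ∈ spectrum ℂ (star α) := mem_spectrum_of_mulVec_eq_smul hf0 hμ
    rw [spectrum.map_star, Set.mem_star] at h1
    have := h.spectrum_le _ h1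
    simpa using this
  have hγ : γᴴ *ᵥ f = 0 := by
    apply qf_one_eq_zero
    set c := qf 1 (γᴴ *ᵥ f) with hc
    refine le_antisymm ?_ (qf_one_nonneg _)
    obtain ⟨C, hC⟩ := hf
    by_contra! hpos
    -- On an eigenvector the derivative of the form is `2c e^{4x Im μ}`, at least `2c` for `x ≥ 0`
    -- since `Im μ ≥ 0`. The form therefore gains at least `2cx`, which exceeds the bound `C` at `x
    -- = (|C| + 1) / (2c)`.
    have hd : ∀ x, HasDerivAt (fun t => qf (QMat α S₀ γ₁ γ t) f - 2 * c * t)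
        (2 * (Real.exp (4 * (x * μ.im)) * c) - 2 * c) x := fun x => by
      have h1 := (hasDerivAt_qf_QMat h f x).sub ((hasDerivAt_id x).const_mul (2 * c))
      refine h1.congr_deriv ?_
      rw [mexp_conjTranspose, mexp_mulVec_of_mulVec_eq_smul _ hμ, Matrix.mulVec_smul, qf_smul,
        Complex.normSq_eq_norm_sq, Complex.norm_exp, ← Real.exp_nat_mul]
      simp
      rw [hc]
      congr 2
      ring
    have hm : MonotoneOn (fun t => qf (QMat α S₀ γ₁ γ t) f - 2 * c * t) (Set.Ici 0) := by
      refine monotoneOn_of_deriv_nonneg (convex_Ici 0)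
        (fun x _ => (hd x).continuousAt.continuousWithinAt)
        (fun x _ => (hd x).differentiableAt.differentiableWithinAt) fun x hx => ?_
      rw [interior_Ici] at hx
      rw [(hd x).deriv]
      have : 1 ≤ Real.exp (4 * (x * μ.im)) :=
        Real.one_le_exp (by have := le_of_lt (Set.mem_Ioi.1 hx); positivity)
      nlinarith
    have hx : 0 ≤ (|C| + 1) / (2 * c) := by positivity
    have h1 := hm Set.self_mem_Ici (Set.mem_Ici.2 hx) hx
    have h2 := hC _ hx
    simp only [QMat_zero, mul_zero, sub_zero] at h1
    rw [qf_sub_matrix] at h2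
    have h3 : 2 * c * ((|C| + 1) / (2 * c)) = |C| + 1 := by field_simp
    rw [h3] at h1
    linarith [le_abs_self C]
  exact hf0 (h.fullRange.eq_zero_of_mulVec_eq_smul hμ hγ)

/-- A nonzero subspace invariant under `α^*` contains an eigenvector of `α^*`, and the bounded
vectors contain none. -/
theorem boundedVectors_eq_bot (h : Admissible α S₀ γ₁ γ) : boundedVectors α S₀ γ₁ γ h = ⊥ := by
  by_contra hne
  set N := boundedVectors α S₀ γ₁ γ h with hN
  have : Nontrivial N := Submodule.nontrivial_iff_ne_bot.2 hne
  let T : Module.End ℂ N := (Matrix.mulVecLin αᴴ).restrict fun f hf => mulVec_mem_boundedVectors h hf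
  obtain ⟨μ, hμ⟩ := Module.End.exists_eigenvalue T
  obtain ⟨f, hf⟩ := hμ.exists_hasEigenvector
  have h1 : αᴴ *ᵥ (f : Fin n → ℂ) = μ • (f : Fin n → ℂ) := congrArg Subtype.val hf.apply_eq_smul
  exact hf.2 (Subtype.ext (boundedVectors_eigenvector_eq_zero h f.2 h1))

/-- The quadratic forms of `Q(x)` tend to infinity uniformly on the unit sphere. -/
theorem eventually_le_qf_QMat (h : Admissible α S₀ γ₁ γ) (K : ℝ) :
    ∀ᶠ x in atTop, ∀ f, K * qf 1 f ≤ qf (QMat α S₀ γ₁ γ x) f := by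
  -- A Dini argument: these compact sets shrink as `x` grows, so if none were empty they would share
  -- a unit vector, along which the form would stay bounded.
  let t : ℝ → Set (Fin n → ℂ) := fun x =>
    {f | f ∈ Metric.sphere (0 : Fin n → ℂ) 1 ∧ qf (QMat α S₀ γ₁ γ x) f ≤ K * qf 1 f}
  have hcl : ∀ x, IsClosed {f | qf (QMat α S₀ γ₁ γ x) f ≤ K * qf 1 f} := fun x =>
    isClosed_le (continuous_qf _) (continuous_const.mul (continuous_qf _))
  have hanti : Antitone t := fun x y hxy f hf => ⟨hf.1, (monotone_qf_QMat h f hxy).trans hf.2⟩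
  obtain ⟨x₀, hx₀⟩ : ∃ x, ¬ (t x).Nonempty := by
    by_contra! hne
    obtain ⟨f, hf⟩ := IsCompact.nonempty_iInter_of_directed_nonempty_isCompact_isClosed t
      hanti.directed_ge hne
      (fun x => (isCompact_sphere (0 : Fin n → ℂ) 1).inter_right (hcl x))
      (fun x => Metric.isClosed_sphere.inter (hcl x))
    rw [Set.mem_iInter] at hf
    have hmem : f ∈ boundedVectors α S₀ γ₁ γ h :=
      ⟨K * qf 1 f - qf S₀ f, fun x _ => by rw [qf_sub_matrix]; linarith [(hf x).2]⟩
    rw [boundedVectors_eq_bot h, Submodule.mem_bot] at hmem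
    have := (hf 0).1
    simp [hmem] at this
  filter_upwards [eventually_ge_atTop x₀] with x hx f
  rcases eq_or_ne f 0 with rfl | hf0
  · simp [qf]
  have hnorm : ‖f‖ ≠ 0 := norm_ne_zero_iff.2 hf0
  -- Both forms scale by the same factor, so the strict inequality on the sphere transfers to every
  -- nonzero vector.
  have hmem : (‖f‖⁻¹ : ℂ) • f ∉ t x₀ := fun hm => hx₀ ⟨_, hm⟩
  have hsph : (‖f‖⁻¹ : ℂ) • f ∈ Metric.sphere (0 : Fin n → ℂ) 1 := by
    simp [norm_smul, hnorm]
  have hlt : K * qf 1 ((‖f‖⁻¹ : ℂ) • f) < qf (QMat α S₀ γ₁ γ x₀) ((‖f‖⁻¹ : ℂ) • f) := by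
    by_contra! hle
    exact hmem ⟨hsph, hle⟩
  rw [qf_smul, qf_smul, mul_left_comm] at hlt
  have hpos : 0 < Complex.normSq (‖f‖⁻¹ : ℂ) := Complex.normSq_pos.2 (by simpa using hf0)
  exact (lt_of_mul_lt_mul_left hlt hpos.le).le.trans (monotone_qf_QMat h f hx)

end Growth

/-! ### Inverses and limits of Hermitian matrices through quadratic forms. -/

section Hermitian

variable {ι : Type*} [Fintype ι] [DecidableEq ι]

theorem det_ne_zero_of_le_qf {M : Matrix ι ι ℂ} {K : ℝ} (hK : 0 < K)
    (h : ∀ f, K * qf 1 f ≤ qf M f) : M.det ≠ 0 := by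
  intro h0
  obtain ⟨f, hf, hMf⟩ := Matrix.exists_mulVec_eq_zero_iff.2 h0
  apply hf
  have h1 := h f
  have h2 : qf M f = 0 := by rw [qf, hMf, dotProduct_zero, Complex.zero_re]
  rw [h2] at h1
  exact qf_one_eq_zero (le_antisymm (by nlinarith) (qf_one_nonneg f))

theorem qf_inv_eq {M : Matrix ι ι ℂ} (hM : M.IsHermitian) (hdet : M.det ≠ 0) (f : ι → ℂ) :
    qf M⁻¹ f = qf M (M⁻¹ *ᵥ f) := by
  have h1 := qf_conj M⁻¹ M f
  rwa [hM.inv.eq, Matrix.nonsing_inv_mul _ (isUnit_iff_ne_zero.2 hdet), Matrix.one_mul] at h1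

theorem qf_inv_nonneg {M : Matrix ι ι ℂ} (hM : M.IsHermitian) (hdet : M.det ≠ 0)
    (h : ∀ f, 0 ≤ qf M f) (f : ι → ℂ) : 0 ≤ qf M⁻¹ f :=
  qf_inv_eq hM hdet f ▸ h _

/-- Expand `0 ≤ ‖(K M⁻¹ - 1) f‖²` and bound `K ‖M⁻¹ f‖²` by `f^* M⁻¹ f`, which is the hypothesis at
the vector `M⁻¹ f`. -/
theorem qf_inv_le {M : Matrix ι ι ℂ} (hM : M.IsHermitian) {K : ℝ} (hK : 0 < K)
    (h : ∀ f, K * qf 1 f ≤ qf M f) (f : ι → ℂ) : K * qf M⁻¹ f ≤ qf 1 f := by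
  have hdet := det_ne_zero_of_le_qf hK h
  have h1 := h (M⁻¹ *ᵥ f)
  rw [← qf_inv_eq hM hdet] at h1
  have h2 := qf_mul_conjTranspose_nonneg ((K : ℂ) • M⁻¹ - 1) f
  have h3 : ((K : ℂ) • M⁻¹ - 1) * ((K : ℂ) • M⁻¹ - 1)ᴴ =
      ((K ^ 2 : ℝ) : ℂ) • (M⁻¹ * M⁻¹ᴴ) - ((2 * K : ℝ) : ℂ) • M⁻¹ + 1 := by
    rw [Matrix.conjTranspose_sub, Matrix.conjTranspose_smul, hM.inv.eq]
    simp only [Complex.star_def, Complex.conj_ofReal, Matrix.conjTranspose_one, sub_mul, mul_sub,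
      Matrix.smul_mul, Matrix.mul_smul, smul_smul, mul_one, one_mul, Complex.ofReal_pow, Complex.ofReal_mul,
      Complex.ofReal_ofNat]
    module
  rw [h3, qf_add_matrix, qf_sub_matrix, qf_ofReal_smul_matrix, qf_ofReal_smul_matrix,
    qf_mul_conjTranspose, hM.inv.eq] at h2
  nlinarith

/-- By polarization each entry is a fixed combination of four values of the form. -/
theorem exists_tendsto_of_tendsto_qf {τ : Type*} {l : Filter τ} {M : τ → Matrix ι ι ℂ}
    (hM : ∀ x, (M x).IsHermitian) {L : (ι → ℂ) → ℝ}
    (h : ∀ f, Tendsto (fun x => qf (M x) f) l (𝓝 (L f))) : ∃ κ, Tendsto M l (𝓝 κ) := by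
  refine ⟨Matrix.of fun p q =>
    ((L (Pi.single p 1 + Pi.single q 1) - L (Pi.single p 1 - Pi.single q 1)) / 4 : ℝ) -
      ((L (Pi.single p 1 + Complex.I • Pi.single q 1) -
        L (Pi.single p 1 - Complex.I • Pi.single q 1)) / 4 : ℝ) * Complex.I, ?_⟩
  rw [tendsto_matrix_iff]
  intro p q
  have e := fun x => IsHermitian_apply_eq (hM x) p q
  rw [funext e]
  have hc : ∀ {g : τ → ℝ} {a : ℝ}, Tendsto g l (𝓝 a) →
      Tendsto (fun x => (g x : ℂ)) l (𝓝 (a : ℂ)) := fun hg =>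
    (Complex.continuous_ofReal.tendsto _).comp hg
  exact (hc (((h _).sub (h _)).div_const 4)).sub
    ((hc (((h _).sub (h _)).div_const 4)).mul_const _)

theorem tendsto_zero_of_tendsto_qf {τ : Type*} {l : Filter τ} {M : τ → Matrix ι ι ℂ}
    (hM : ∀ x, (M x).IsHermitian)
    (h : ∀ f, Tendsto (fun x => qf (M x) f) l (𝓝 0)) : Tendsto M l (𝓝 0) := by
  rw [tendsto_matrix_iff]
  intro p q
  rw [funext fun x => IsHermitian_apply_eq (hM x) p q]
  have hc : ∀ {g : τ → ℝ} {a : ℝ}, Tendsto g l (𝓝 a) →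
      Tendsto (fun x => (g x : ℂ)) l (𝓝 (a : ℂ)) := fun hg =>
    (Complex.continuous_ofReal.tendsto _).comp hg
  simpa using (hc (((h (Pi.single p 1 + Pi.single q 1)).sub
    (h (Pi.single p 1 - Pi.single q 1))).div_const 4)).sub
    ((hc (((h (Pi.single p 1 + Complex.I • Pi.single q 1)).sub
    (h (Pi.single p 1 - Complex.I • Pi.single q 1))).div_const 4)).mul_const Complex.I)

end Hermitian

/-! ### Limits of `Q⁻¹`, `R⁻¹` and `R⁻¹ e^{-2ixα}`. -/

section Limits

variable {n m₁ m₂ : ℕ} {α S₀ : Matrix (Fin n) (Fin n) ℂ} {γ₁ : Matrix (Fin n) (Fin m₁) ℂ}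
  {γ : Matrix (Fin n) (Fin m₂) ℂ}

theorem det_mexp_ne_zero (A : Matrix (Fin n) (Fin n) ℂ) (z : ℂ) : (mexp z A).det ≠ 0 :=
  Matrix.det_ne_zero_of_right_inverse (mexp_mul_mexp_neg A z)

theorem RMat_eq_conj_QMat (x : ℝ) : RMat α S₀ γ₁ γ x =
    mexp (-(2 * (Complex.I * x))) α * QMat α S₀ γ₁ γ x *
      (mexp (-(2 * (Complex.I * x))) α)ᴴ := by
  have h : mexp (-(2 * (Complex.I * x))) α * mexp (Complex.I * x) α =
      mexp (-(Complex.I * x)) α := by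
    rw [mexp_mul_mexp]
    congr 1
    ring
  rw [RMat_eq, QMat, ← h, Matrix.conjTranspose_mul]
  simp only [Matrix.mul_assoc]

theorem RMat_isHermitian (hS₀ : S₀.IsHermitian) (x : ℝ) : (RMat α S₀ γ₁ γ x).IsHermitian := by
  rw [RMat_eq]
  exact Matrix.isHermitian_mul_mul_conjTranspose _ (SMat_isHermitian hS₀ x)

theorem inv_SMat_eq_QMat (x : ℝ) : (SMat α S₀ γ₁ γ x)⁻¹ =
    (mexp (Complex.I * x) α)ᴴ * (QMat α S₀ γ₁ γ x)⁻¹ * mexp (Complex.I * x) α := by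
  have h := isUnit_iff_ne_zero.2 (det_mexp_ne_zero α (Complex.I * x))
  have h' : IsUnit (mexp (Complex.I * x) α)ᴴ.det := by
    rw [Matrix.det_conjTranspose]; exact h.star
  rw [QMat, Matrix.mul_inv_rev, Matrix.mul_inv_rev]
  simp only [Matrix.mul_assoc]
  rw [Matrix.nonsing_inv_mul _ h, Matrix.mul_one, ← Matrix.mul_assoc, Matrix.mul_nonsing_inv _ h',
    Matrix.one_mul]

theorem inv_SMat_eq_RMat (x : ℝ) : (SMat α S₀ γ₁ γ x)⁻¹ =
    (mexp (-(Complex.I * x)) α)ᴴ * (RMat α S₀ γ₁ γ x)⁻¹ * mexp (-(Complex.I * x)) α := by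
  have h := isUnit_iff_ne_zero.2 (det_mexp_ne_zero α (-(Complex.I * x)))
  have h' : IsUnit (mexp (-(Complex.I * x)) α)ᴴ.det := by
    rw [Matrix.det_conjTranspose]; exact h.star
  rw [RMat_eq, Matrix.mul_inv_rev, Matrix.mul_inv_rev]
  simp only [Matrix.mul_assoc]
  rw [Matrix.nonsing_inv_mul _ h, Matrix.mul_one, ← Matrix.mul_assoc, Matrix.mul_nonsing_inv _ h',
    Matrix.one_mul]

theorem inv_QMat_eq_RMat (x : ℝ) : (QMat α S₀ γ₁ γ x)⁻¹ =
    (mexp (-(2 * (Complex.I * x))) α)ᴴ * (RMat α S₀ γ₁ γ x)⁻¹ *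
      mexp (-(2 * (Complex.I * x))) α := by
  have h := isUnit_iff_ne_zero.2 (det_mexp_ne_zero α (-(2 * (Complex.I * x))))
  have h' : IsUnit (mexp (-(2 * (Complex.I * x))) α)ᴴ.det := by
    rw [Matrix.det_conjTranspose]; exact h.star
  rw [RMat_eq_conj_QMat, Matrix.mul_inv_rev, Matrix.mul_inv_rev]
  simp only [Matrix.mul_assoc]
  rw [Matrix.nonsing_inv_mul _ h, Matrix.mul_one, ← Matrix.mul_assoc, Matrix.mul_nonsing_inv _ h',
    Matrix.one_mul]

theorem det_RMat_ne_zero_iff (x : ℝ) :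
    (RMat α S₀ γ₁ γ x).det ≠ 0 ↔ (SMat α S₀ γ₁ γ x).det ≠ 0 := by
  rw [RMat, Matrix.det_mul, Matrix.det_mul]
  simp [det_mexp_ne_zero]

/-- `R` is congruent to `Q` through an invertible matrix, and `Q` is eventually positive definite.
-/
theorem eventually_qf_RMat_nonneg (h : Admissible α S₀ γ₁ γ) :
    ∀ᶠ x in atTop, (RMat α S₀ γ₁ γ x).det ≠ 0 ∧ ∀ f, 0 ≤ qf (RMat α S₀ γ₁ γ x) f := by
  filter_upwards [eventually_le_qf_QMat h 1] with x hx
  have hdet := det_ne_zero_of_le_qf one_pos hx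
  constructor
  · rw [RMat_eq_conj_QMat, Matrix.det_mul, Matrix.det_mul, Matrix.det_conjTranspose]
    exact mul_ne_zero (mul_ne_zero (det_mexp_ne_zero _ _) hdet)
      (star_ne_zero.2 (det_mexp_ne_zero _ _))
  · intro f
    rw [RMat_eq_conj_QMat, qf_conj]
    exact le_trans (by have := qf_one_nonneg ((mexp (-(2 * (Complex.I * x))) α)ᴴ *ᵥ f); linarith)
      (hx _)

theorem tendsto_inv_QMat (h : Admissible α S₀ γ₁ γ) :
    Tendsto (fun x => (QMat α S₀ γ₁ γ x)⁻¹) atTop (𝓝 0) := by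
  refine tendsto_zero_of_tendsto_qf (fun x => (QMat_isHermitian h.hermitian x).inv) fun f => ?_
  rw [Metric.tendsto_nhds]
  intro ε hε
  have hf := qf_one_nonneg f
  have hK : 0 < (qf 1 f + 1) / ε := by positivity
  filter_upwards [eventually_le_qf_QMat h ((qf 1 f + 1) / ε)] with x hx
  have hH := QMat_isHermitian (α := α) (γ₁ := γ₁) (γ := γ) h.hermitian x
  have h1 := qf_inv_le hH hK hx f
  have h2 := qf_inv_nonneg hH (det_ne_zero_of_le_qf hK hx)
    (fun g => le_trans (mul_nonneg hK.le (qf_one_nonneg g)) (hx g)) f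
  rw [Real.dist_eq, sub_zero, abs_of_nonneg h2]
  rw [div_mul_eq_mul_div, div_le_iff₀ hε] at h1
  nlinarith

/-- Where `R` is invertible, `(R⁻¹)' = -R⁻¹ R' R⁻¹` is nonpositive, since `R'` is twice a matrix `B
B^*`. Each form of `R⁻¹` is thus eventually decreasing, and bounded below by zero. -/
theorem exists_tendsto_inv_RMat (h : Admissible α S₀ γ₁ γ) :
    ∃ κ, Tendsto (fun x => (RMat α S₀ γ₁ γ x)⁻¹) atTop (𝓝 κ) := by
  obtain ⟨x₀, hx₀⟩ := eventually_atTop.1 (eventually_qf_RMat_nonneg h)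
  have hH := RMat_isHermitian (α := α) (γ₁ := γ₁) (γ := γ) h.hermitian
  have hd : ∀ f, ∀ x ≥ x₀, HasDerivAt (fun t => qf (RMat α S₀ γ₁ γ t)⁻¹ f)
      (-(2 * qf 1 (((RMat α S₀ γ₁ γ x)⁻¹ * mexp (-(2 * (Complex.I * x))) α * γ₁)ᴴ *ᵥ f))) x := by
    intro f x hx
    have h1 := (((hasMatDerivWithinAt_RMat (s := Set.univ) (x := x) h.identity).inv
      (hx₀ x hx).1).qf f)
    rw [hasDerivWithinAt_univ] at h1
    refine h1.congr_deriv ?_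
    rw [qf_neg_matrix, ← qf_mul_conjTranspose, ← qf_ofReal_smul_matrix]
    congr 2
    rw [Matrix.conjTranspose_mul, Matrix.conjTranspose_mul, (hH x).inv.eq]
    simp only [Matrix.mul_assoc, Matrix.smul_mul, Matrix.mul_smul, Complex.ofReal_ofNat]
  have hanti : ∀ f, AntitoneOn (fun t => qf (RMat α S₀ γ₁ γ t)⁻¹ f) (Set.Ici x₀) := fun f =>
    antitoneOn_of_deriv_nonpos (convex_Ici x₀)
      (fun x hx => (hd f x hx).continuousAt.continuousWithinAt)
      (fun x hx => (hd f x (interior_subset hx)).differentiableAt.differentiableWithinAt)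
      fun x hx => by
        rw [(hd f x (interior_subset hx)).deriv, neg_nonpos]
        exact mul_nonneg two_pos.le (qf_one_nonneg _)
  refine exists_tendsto_of_tendsto_qf (fun x => (hH x).inv)
    -- Truncating the argument at `x₀` makes the function antitone and bounded below on the whole
    -- line, so its limit is an infimum.
    (L := fun f => ⨅ x, qf (RMat α S₀ γ₁ γ (max x x₀))⁻¹ f) fun f => ?_
  have hlim : Tendsto (fun x => qf (RMat α S₀ γ₁ γ (max x x₀))⁻¹ f) atTop
      (𝓝 (⨅ x, qf (RMat α S₀ γ₁ γ (max x x₀))⁻¹ f)) := by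
    refine tendsto_atTop_ciInf (fun x y hxy => hanti f (Set.mem_Ici.2 (le_max_right x x₀))
      (Set.mem_Ici.2 (le_max_right y x₀)) (max_le_max_right _ hxy)) ⟨0, ?_⟩
    rintro _ ⟨x, rfl⟩
    have := hx₀ _ (le_max_right x x₀)
    exact qf_inv_nonneg (hH _) this.1 this.2 f
  refine hlim.congr' ?_
  filter_upwards [eventually_ge_atTop x₀] with x hx
  rw [max_eq_left hx]

/-- No bound on `e^{-2ixα}` is needed: the squared entries are at most `(R⁻¹)_pp (Q⁻¹)_qq`, where
the first factor converges and the second tends to zero. -/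
theorem tendsto_inv_RMat_mul_mexp (h : Admissible α S₀ γ₁ γ) :
    Tendsto (fun x : ℝ => (RMat α S₀ γ₁ γ x)⁻¹ * mexp (-(2 * (Complex.I * x))) α)
      atTop (𝓝 0) := by
  obtain ⟨κ, hκ⟩ := exists_tendsto_inv_RMat h
  rw [tendsto_matrix_iff]
  intro p q
  have h1 : Tendsto (fun x => ((RMat α S₀ γ₁ γ x)⁻¹ p p).re * ((QMat α S₀ γ₁ γ x)⁻¹ q q).re)
      atTop (𝓝 0) := by
    have e1 := (Complex.continuous_re.tendsto _).comp (tendsto_matrix_iff.1 hκ p p)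
    have e2 := (Complex.continuous_re.tendsto _).comp
      (tendsto_matrix_iff.1 (tendsto_inv_QMat h) q q)
    simpa using e1.mul e2
  have h2 : Tendsto (fun x : ℝ =>
      ‖((RMat α S₀ γ₁ γ x)⁻¹ * mexp (-(2 * (Complex.I * x))) α) p q‖ ^ 2) atTop (𝓝 0) := by
    refine squeeze_zero' (Eventually.of_forall fun x => sq_nonneg _) ?_ h1
    filter_upwards [eventually_qf_RMat_nonneg h] with x hx
    have hH := RMat_isHermitian (α := α) (γ₁ := γ₁) (γ := γ) h.hermitian x
    rw [inv_QMat_eq_RMat]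
    exact norm_mul_apply_sq_le hH.inv (qf_inv_nonneg hH hx.1 hx.2) _ p q
  rw [Matrix.zero_apply, tendsto_zero_iff_norm_tendsto_zero]
  have h3 := h2.sqrt
  simpa [Real.sqrt_sq (norm_nonneg _)] using h3

end Limits

/-! ### The Darboux matrix and the fundamental solution -/

section Darboux

variable {n m₁ m₂ : ℕ}

theorem jMat_mul_self : jMat m₁ m₂ * jMat m₁ m₂ = 1 := by
  simp [jMat, Matrix.fromBlocks_multiply]

theorem jMat_mul_jMat_mul {κ : Type*} (B : Matrix (Fin m₁ ⊕ Fin m₂) κ ℂ) :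
    jMat m₁ m₂ * (jMat m₁ m₂ * B) = B := by
  rw [← Matrix.mul_assoc, jMat_mul_self, Matrix.one_mul]

theorem jMat_conjTranspose : (jMat m₁ m₂)ᴴ = jMat m₁ m₂ := by
  simp [jMat, Matrix.fromBlocks_conjTranspose]

variable (α S₀ : Matrix (Fin n) (Fin n) ℂ) (γ₁ : Matrix (Fin n) (Fin m₁) ℂ)
  (γ : Matrix (Fin n) (Fin m₂) ℂ)

/-- The Darboux matrix `w(x, λ) = I + i j Λ(x)^* S(x)^{-1} (λ - α)^{-1} Λ(x)`. -/
def darboux (lam : ℝ) (x : ℝ) : Matrix (Fin m₁ ⊕ Fin m₂) (Fin m₁ ⊕ Fin m₂) ℂ :=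
  1 + Complex.I • (jMat m₁ m₂ *
    ((Lam α γ₁ γ x)ᴴ * ((SMat α S₀ γ₁ γ x)⁻¹ * (res lam α * Lam α γ₁ γ x))))

variable {α S₀ γ₁ γ}

theorem mem_spectrum_iff {A : Matrix (Fin n) (Fin n) ℂ} {lam : ℝ} :
    (lam : ℂ) ∉ spectrum ℂ A ↔ ((lam : ℂ) • (1 : Matrix (Fin n) (Fin n) ℂ) - A).det ≠ 0 := by
  rw [spectrum.notMem_iff, Algebra.algebraMap_eq_smul_one, Matrix.isUnit_iff_isUnit_det,
    isUnit_iff_ne_zero]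

theorem mul_res {A : Matrix (Fin n) (Fin n) ℂ} {lam : ℝ} (h : (lam : ℂ) ∉ spectrum ℂ A) :
    ((lam : ℂ) • (1 : Matrix (Fin n) (Fin n) ℂ) - A) * res lam A = 1 :=
  Matrix.mul_nonsing_inv _ (isUnit_iff_ne_zero.2 (mem_spectrum_iff.1 h))

theorem res_mul {A : Matrix (Fin n) (Fin n) ℂ} {lam : ℝ} (h : (lam : ℂ) ∉ spectrum ℂ A) :
    res lam A * ((lam : ℂ) • (1 : Matrix (Fin n) (Fin n) ℂ) - A) = 1 :=
  Matrix.nonsing_inv_mul _ (isUnit_iff_ne_zero.2 (mem_spectrum_iff.1 h))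

theorem res_conjTranspose (A : Matrix (Fin n) (Fin n) ℂ) (lam : ℝ) :
    (res lam A)ᴴ = res lam Aᴴ := by
  rw [res, res, Matrix.conjTranspose_nonsing_inv, Matrix.conjTranspose_sub,
    Matrix.conjTranspose_smul, Matrix.conjTranspose_one]
  simp

theorem mul_res_eq {A : Matrix (Fin n) (Fin n) ℂ} {lam : ℝ} (h : (lam : ℂ) ∉ spectrum ℂ A) :
    A * res lam A = (lam : ℂ) • res lam A - 1 := by
  have := mul_res h
  rw [sub_mul, Matrix.smul_mul, Matrix.one_mul] at this
  rw [← this]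
  abel

theorem res_mul_eq {A : Matrix (Fin n) (Fin n) ℂ} {lam : ℝ} (h : (lam : ℂ) ∉ spectrum ℂ A) :
    res lam A * A = (lam : ℂ) • res lam A - 1 := by
  have := res_mul h
  rw [mul_sub, Matrix.mul_smul, Matrix.mul_one] at this
  rw [← this]
  abel

/-- The potential: `i j V = X - j X j` for `X = Λ^* S^{-1} Λ`. -/
theorem jMat_mul_VMat_eq {v : ℝ → Matrix (Fin m₁) (Fin m₂) ℂ} (hv : DeterminedBy v α S₀ γ₁ γ)
    {x : ℝ} (hx : 0 ≤ x) (hs : x ∉ singularSet α S₀ γ₁ γ) :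
    Complex.I • (jMat m₁ m₂ * VMat (v x)) =
      (Lam α γ₁ γ x)ᴴ * (SMat α S₀ γ₁ γ x)⁻¹ * Lam α γ₁ γ x -
        jMat m₁ m₂ * ((Lam α γ₁ γ x)ᴴ * (SMat α S₀ γ₁ γ x)⁻¹ * Lam α γ₁ γ x) * jMat m₁ m₂ := by
  have hf := hv.formula x hx hs
  have hS := (SMat_isHermitian (α := α) (γ₁ := γ₁) (γ := γ) hv.admissible.hermitian x).inv.eq
  set T := (SMat α S₀ γ₁ γ x)⁻¹
  have hX : (Lam α γ₁ γ x)ᴴ * T * Lam α γ₁ γ x = Matrix.fromBlocks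
      ((mexp (-(Complex.I * x)) α * γ₁)ᴴ * T * (mexp (-(Complex.I * x)) α * γ₁))
      ((mexp (-(Complex.I * x)) α * γ₁)ᴴ * T * (mexp (Complex.I * x) α * γ))
      ((mexp (Complex.I * x) α * γ)ᴴ * T * (mexp (-(Complex.I * x)) α * γ₁))
      ((mexp (Complex.I * x) α * γ)ᴴ * T * (mexp (Complex.I * x) α * γ)) := by
    rw [Lam, Matrix.conjTranspose_fromCols_eq_fromRows_conjTranspose, Matrix.fromRows_mul,
      Matrix.fromRows_mul_fromCols]
  have h12 : (mexp (-(Complex.I * x)) α * γ₁)ᴴ * T * (mexp (Complex.I * x) α * γ) =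
      (Complex.I / 2) • v x := by
    rw [hf, Matrix.conjTranspose_mul, conjTranspose_mexp_neg_I, smul_smul]
    have : Complex.I / 2 * (-2 * Complex.I) = 1 := by
      rw [show Complex.I / 2 * (-2 * Complex.I) = -(Complex.I * Complex.I) by ring,
        Complex.I_mul_I, neg_neg]
    rw [this, one_smul]
    simp only [Matrix.mul_assoc]
  have h21 : (mexp (Complex.I * x) α * γ)ᴴ * T * (mexp (-(Complex.I * x)) α * γ₁) =
      (-(Complex.I / 2)) • (v x)ᴴ := by
    have hadj : ∀ (A : Matrix (Fin n) (Fin m₁) ℂ) (B : Matrix (Fin n) (Fin m₂) ℂ),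
        Bᴴ * T * A = (Aᴴ * T * B)ᴴ := fun A B => by
      rw [Matrix.conjTranspose_mul, Matrix.conjTranspose_mul, Matrix.conjTranspose_conjTranspose, hS,
        Matrix.mul_assoc]
    rw [hadj, h12, Matrix.conjTranspose_smul]
    simp [neg_div]
  rw [hX, h12, h21, jMat, VMat, Matrix.fromBlocks_multiply, Matrix.fromBlocks_multiply,
    Matrix.fromBlocks_multiply, Matrix.fromBlocks_smul, sub_eq_add_neg, Matrix.fromBlocks_neg,
    Matrix.fromBlocks_add]
  simp only [Matrix.one_mul, Matrix.mul_one, Matrix.zero_mul, Matrix.mul_zero, add_zero, zero_add,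
    Matrix.neg_mul, Matrix.mul_neg, neg_neg, smul_zero, add_neg_cancel]
  congr 1 <;> module

/-- `Λ^* S^{-1}` solves a linear differential equation. -/
theorem hasMatDerivWithinAt_jMat_mul_Lam_mul_inv
    (h : Admissible α S₀ γ₁ γ) {s : Set ℝ} {x : ℝ} (hs : (SMat α S₀ γ₁ γ x).det ≠ 0) :
    HasMatDerivWithinAt (fun t => jMat m₁ m₂ * ((Lam α γ₁ γ t)ᴴ * (SMat α S₀ γ₁ γ t)⁻¹))
      (Complex.I • ((Lam α γ₁ γ x)ᴴ * (SMat α S₀ γ₁ γ x)⁻¹ * α) +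
        ((Lam α γ₁ γ x)ᴴ * (SMat α S₀ γ₁ γ x)⁻¹ * Lam α γ₁ γ x * jMat m₁ m₂ -
          jMat m₁ m₂ * ((Lam α γ₁ γ x)ᴴ * (SMat α S₀ γ₁ γ x)⁻¹ * Lam α γ₁ γ x)) *
          ((Lam α γ₁ γ x)ᴴ * (SMat α S₀ γ₁ γ x)⁻¹)) s x := by
  refine (((hasMatDerivWithinAt_Lam α γ₁ γ).conjTranspose.mul
    ((hasMatDerivWithinAt_SMat α S₀ γ₁ γ).inv hs)).const_mul _).congr_deriv ?_
  have hid := SMat_identity h.identity x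
  set S := SMat α S₀ γ₁ γ x
  set L := Lam α γ₁ γ x
  have hu := isUnit_iff_ne_zero.2 hs
  -- This is the identity for `S(x)` multiplied by `S⁻¹` on both sides; it moves `α^*` past `S⁻¹`.
  have hT : αᴴ * S⁻¹ = S⁻¹ * α - Complex.I • (S⁻¹ * (L * (jMat m₁ m₂ * (Lᴴ * S⁻¹)))) := by
    have e : S⁻¹ * (α * S - S * αᴴ) * S⁻¹ = S⁻¹ * α - αᴴ * S⁻¹ := by
      rw [Matrix.mul_sub, Matrix.sub_mul, Matrix.mul_assoc, Matrix.mul_assoc,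
        Matrix.mul_nonsing_inv _ hu, Matrix.mul_one, ← Matrix.mul_assoc S⁻¹ S,
        Matrix.nonsing_inv_mul _ hu, Matrix.one_mul]
    rw [hid] at e
    simp only [Matrix.mul_smul, Matrix.smul_mul, Matrix.mul_assoc] at e
    rw [e]
    abel
  simp only [Matrix.conjTranspose_neg, Matrix.conjTranspose_smul, Matrix.conjTranspose_mul,
    jMat_conjTranspose, Matrix.mul_assoc, Matrix.mul_neg, Matrix.smul_mul,
    Matrix.mul_smul, Matrix.mul_add, Matrix.sub_mul, hT, Matrix.mul_sub, jMat_mul_jMat_mul, smul_sub,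
    smul_smul, Complex.star_def, Complex.conj_I, neg_smul, Complex.I_mul_I, one_smul, neg_neg]
  module

/-- Next to the resolvent, `α` becomes `λ` up to the remainder `-I`. The `λ` terms form the
commutator of `j` and `w`; the remainders supply the constant part of the potential term `(X - jXj)
w`, where `X = Λ^* S⁻¹ Λ`. -/
theorem hasMatDerivWithinAt_darboux {v : ℝ → Matrix (Fin m₁) (Fin m₂) ℂ}
    (hv : DeterminedBy v α S₀ γ₁ γ) {lam : ℝ} (hlam : (lam : ℂ) ∉ spectrum ℂ α) {s : Set ℝ} {x : ℝ}
    (hx : 0 ≤ x) (hs : x ∉ singularSet α S₀ γ₁ γ) :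
    HasMatDerivWithinAt (darboux α S₀ γ₁ γ lam)
      ((Complex.I * lam) • (jMat m₁ m₂ * darboux α S₀ γ₁ γ lam x -
        darboux α S₀ γ₁ γ lam x * jMat m₁ m₂) +
        Complex.I • (jMat m₁ m₂ * VMat (v x)) * darboux α S₀ γ₁ γ lam x) s x := by
  have hQ := jMat_mul_VMat_eq hv hx hs
  have hP := hasMatDerivWithinAt_jMat_mul_Lam_mul_inv (s := s) hv.admissible hs
  have hL := hasMatDerivWithinAt_Lam (s := s) (x := x) α γ₁ γ
  have hw : darboux α S₀ γ₁ γ lam = fun t => 1 + Complex.I •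
      (jMat m₁ m₂ * ((Lam α γ₁ γ t)ᴴ * (SMat α S₀ γ₁ γ t)⁻¹) * (res lam α * Lam α γ₁ γ t)) := by
    funext t
    simp only [darboux, Matrix.mul_assoc]
  rw [hw]
  refine ((hasMatDerivWithinAt_const _).add
    ((hP.mul (hL.const_mul (res lam α))).const_smul Complex.I)).congr_deriv ?_
  rw [hQ]
  set T := (SMat α S₀ γ₁ γ x)⁻¹
  set L := Lam α γ₁ γ x
  have hr1 : ∀ B : Matrix (Fin n) (Fin m₁ ⊕ Fin m₂) ℂ,
      α * (res lam α * B) = (lam : ℂ) • (res lam α * B) - B := fun B => by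
    rw [← Matrix.mul_assoc, mul_res_eq hlam, Matrix.sub_mul, Matrix.smul_mul, Matrix.one_mul]
  have hr2 : ∀ B : Matrix (Fin n) (Fin m₁ ⊕ Fin m₂) ℂ,
      res lam α * (α * B) = (lam : ℂ) • (res lam α * B) - B := fun B => by
    rw [← Matrix.mul_assoc, res_mul_eq hlam, Matrix.sub_mul, Matrix.smul_mul, Matrix.one_mul]
  simp only [Matrix.mul_assoc, Matrix.mul_neg, Matrix.smul_mul,
    Matrix.mul_smul, Matrix.mul_add, Matrix.add_mul, Matrix.sub_mul, hr1, hr2, Matrix.mul_sub,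
    jMat_mul_jMat_mul, smul_sub, smul_add, Matrix.mul_one, Matrix.one_mul,
    smul_smul, zero_add]
  match_scalars <;> ring_nf
  all_goals simp only [Complex.I_sq]
  ring

/-- `ΛjΛ^* = -i(S(λ - α^*) - (λ - α)S)`, so in the quadratic term the resolvents cancel (here `λ` is
real) and leave exactly the negative of the two linear terms. -/
theorem darboux_conjTranspose_mul_jMat_mul (h : Admissible α S₀ γ₁ γ) {lam : ℝ}
    (hlam : (lam : ℂ) ∉ spectrum ℂ α) {x : ℝ} (hs : (SMat α S₀ γ₁ γ x).det ≠ 0) :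
    (darboux α S₀ γ₁ γ lam x)ᴴ * (jMat m₁ m₂ * darboux α S₀ γ₁ γ lam x) = jMat m₁ m₂ := by
  have hid := SMat_identity h.identity x
  have hH := (SMat_isHermitian (α := α) (γ₁ := γ₁) (γ := γ) h.hermitian x).inv.eq
  rw [darboux]
  set S := SMat α S₀ γ₁ γ x
  set L := Lam α γ₁ γ x
  have hu := isUnit_iff_ne_zero.2 hs
  have hρ := res_conjTranspose α lam
  have e1 : res lam αᴴ * ((lam : ℂ) • 1 - αᴴ) = 1 := by
    have := congrArg Matrix.conjTranspose (mul_res hlam)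
    rw [Matrix.conjTranspose_mul, hρ, Matrix.conjTranspose_one, Matrix.conjTranspose_sub,
      Matrix.conjTranspose_smul, Matrix.conjTranspose_one] at this
    simpa using this
  have key : (res lam α)ᴴ * (S⁻¹ * (L * (jMat m₁ m₂ * (Lᴴ * (S⁻¹ * res lam α))))) =
      (-Complex.I) • (S⁻¹ * res lam α - (res lam α)ᴴ * S⁻¹) := by
    have e2 : L * jMat m₁ m₂ * Lᴴ =
        (-Complex.I) • (S * ((lam : ℂ) • 1 - αᴴ) - ((lam : ℂ) • 1 - α) * S) := by
      rw [show S * ((lam : ℂ) • 1 - αᴴ) - ((lam : ℂ) • 1 - α) * S = α * S - S * αᴴ by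
        simp only [Matrix.mul_sub, Matrix.sub_mul, Matrix.mul_smul, Matrix.smul_mul, Matrix.mul_one,
          Matrix.one_mul]
        abel, hid, smul_smul]
      simp
    have e3 : (res lam α)ᴴ * (S⁻¹ * (L * (jMat m₁ m₂ * (Lᴴ * (S⁻¹ * res lam α))))) =
        (res lam α)ᴴ * (S⁻¹ * ((L * jMat m₁ m₂ * Lᴴ) * (S⁻¹ * res lam α))) := by
      simp only [Matrix.mul_assoc]
    rw [e3, e2, Matrix.smul_mul, Matrix.mul_smul, Matrix.mul_smul, Matrix.sub_mul, Matrix.mul_sub,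
      Matrix.mul_sub]
    congr 2
    · rw [hρ, ← Matrix.mul_assoc S⁻¹, ← Matrix.mul_assoc S⁻¹, Matrix.nonsing_inv_mul _ hu,
        Matrix.one_mul, ← Matrix.mul_assoc, e1, Matrix.one_mul]
    · rw [Matrix.mul_assoc, ← Matrix.mul_assoc S, Matrix.mul_nonsing_inv _ hu, Matrix.one_mul,
        mul_res hlam, Matrix.mul_one]
  have key' : (res lam α)ᴴ * (S⁻¹ * (L * (jMat m₁ m₂ * (Lᴴ * (S⁻¹ * (res lam α * L)))))) =
      (-Complex.I) • (S⁻¹ * (res lam α * L) - (res lam α)ᴴ * (S⁻¹ * L)) := by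
    have := congrArg (· * L) key
    simpa only [Matrix.mul_assoc, Matrix.smul_mul, Matrix.sub_mul] using this
  simp only [Matrix.conjTranspose_add, Matrix.conjTranspose_one, Matrix.conjTranspose_smul,
    Matrix.conjTranspose_mul, jMat_conjTranspose, hH, Matrix.conjTranspose_conjTranspose,
    Matrix.mul_assoc, Matrix.add_mul, Matrix.mul_add, Matrix.smul_mul, Matrix.mul_smul, smul_smul,
    jMat_mul_jMat_mul, jMat_mul_self, key', Matrix.one_mul, Matrix.mul_one, Complex.star_def,
    Complex.conj_I, smul_sub, Matrix.mul_sub]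
  simp

end Darboux

/-! ### Uniqueness of meromorphically continued solutions -/

section Uniqueness

variable {ι κ : Type*} [Fintype ι] [DecidableEq ι]

/-- A meromorphic solution of a linear differential equation on `[0, ∞)` outside of a closed
singular set is determined by its initial value through any meromorphic fundamental solution. -/
theorem eq_fundamental_mul {A U : ℝ → Matrix ι ι ℂ} {u : ℝ → Matrix ι κ ℂ} {sing : Set ℝ}
    (hsing : IsClosed sing) (h0 : (0 : ℝ) ∉ sing)
    (hU : ∀ x, 0 ≤ x → x ∉ sing → HasMatDerivWithinAt U (A x * U x) (Set.Ici 0) x)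
    (hdet : ∀ x, 0 ≤ x → x ∉ sing → (U x).det ≠ 0)
    (hUmero : ∀ x > 0, ∀ p q, MeromorphicAt (fun t => U t p q) x)
    (hu : ∀ x, 0 ≤ x → x ∉ sing → HasMatDerivWithinAt u (A x * u x) (Set.Ici 0) x)
    (humero : ∀ x > 0, ∀ p q, MeromorphicAt (fun t => u t p q) x)
    {x : ℝ} (hx : 0 ≤ x) (hxs : x ∉ sing) : u x = U x * ((U 0)⁻¹ * u 0) := by
  set C : ℝ → Matrix ι κ ℂ := fun t => (U t)⁻¹ * u t with hC
  -- `U⁻¹u` is locally constant off the singular set. It is constant on some `[0, ε)`, and the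
  -- remaining task is to carry this value across the singularities.
  have hCd : ∀ x, 0 ≤ x → x ∉ sing → HasMatDerivWithinAt C 0 (Set.Ici 0) x := fun y hy hys => by
    refine (((hU y hy hys).inv (hdet y hy hys)).mul (hu y hy hys)).congr_deriv ?_
    simp only [Matrix.mul_assoc, Matrix.neg_mul]
    rw [← Matrix.mul_assoc (U y) (U y)⁻¹,
      Matrix.mul_nonsing_inv _ (isUnit_iff_ne_zero.2 (hdet y hy hys)), Matrix.one_mul, neg_add_cancel]
  obtain ⟨ε, hε, hball⟩ := Metric.isOpen_iff.1 hsing.isOpen_compl 0 h0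
  have hns : ∀ b, 0 ≤ b → b < ε → b ∉ sing := fun b hb hbε =>
    hball (by rwa [Metric.mem_ball, Real.dist_eq, sub_zero, abs_of_nonneg hb])
  have hnear : ∀ b, 0 ≤ b → b < ε → C b = C 0 := fun b hb hbε =>
    eq_of_hasMatDerivWithinAt_zero hb fun y hy =>
      (hCd y hy.1 (hns y hy.1 (hy.2.trans_lt hbε))).mono Set.Icc_subset_Ici_self
  have key : C x = C 0 := by
    rcases hx.eq_or_lt with rfl | hpos
    · rfl
    ext p q
    set g : ℝ → ℂ := fun t => C t p q - C 0 p q with hg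
    have hgm : MeromorphicOn g (Set.Ioi 0) := fun y hy =>
      (meromorphicAt_matrix_mul (meromorphicAt_matrix_inv (hUmero y hy)) (humero y hy) p q).fun_sub
        (MeromorphicAt.const _ _)
    have htop : meromorphicOrderAt g (ε / 2) = ⊤ := by
      rw [meromorphicOrderAt_eq_top_iff]
      refine Filter.Eventually.filter_mono nhdsWithin_le_nhds ?_
      filter_upwards [Ioo_mem_nhds (half_pos hε) (half_lt_self hε)] with y hy
      simp only [hg, hnear y hy.1.le hy.2, sub_self]
    -- A meromorphic function on the connected set `(0, ∞)` that vanishes near one point has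
    -- infinite order everywhere. This gives vanishing only on punctured neighbourhoods; continuity
    -- at nonsingular `x` gives the value itself.
    have htopx : meromorphicOrderAt g x = ⊤ := by
      by_contra hne
      exact hgm.meromorphicOrderAt_ne_top_of_isPreconnected isPreconnected_Ioi
        (Set.mem_Ioi.2 hpos) (Set.mem_Ioi.2 (half_pos hε)) hne htop
    rw [meromorphicOrderAt_eq_top_iff] at htopx
    have hcont : Tendsto g (𝓝[≠] x) (𝓝 (g x)) := by
      have h1 := (hCd x hx hxs p q).continuousWithinAt.continuousAt (Ici_mem_nhds hpos)
      exact (h1.sub continuousAt_const).tendsto.mono_left nhdsWithin_le_nhds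
    have hzero : Tendsto g (𝓝[≠] x) (𝓝 0) :=
      tendsto_const_nhds.congr' (htopx.mono fun y hy => hy.symm)
    exact sub_eq_zero.1 (tendsto_nhds_unique hcont hzero)
  change u x = U x * C 0
  rw [← key, hC, ← Matrix.mul_assoc, Matrix.mul_nonsing_inv _ (isUnit_iff_ne_zero.2 (hdet x hx hxs)),
    Matrix.one_mul]

end Uniqueness

/-! ### The fundamental solution `w e^{ixλj}`. -/

section Fundamental

variable {n m₁ m₂ : ℕ} {α S₀ : Matrix (Fin n) (Fin n) ℂ} {γ₁ : Matrix (Fin n) (Fin m₁) ℂ}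
  {γ : Matrix (Fin n) (Fin m₂) ℂ} {v : ℝ → Matrix (Fin m₁) (Fin m₂) ℂ} {lam : ℝ}

variable (m₁ m₂) in
/-- The free evolution `e^{ixλj}`. -/
def phase (lam x : ℝ) : Matrix (Fin m₁ ⊕ Fin m₂) (Fin m₁ ⊕ Fin m₂) ℂ :=
  Matrix.fromBlocks (Complex.exp (Complex.I * x * lam) • 1) 0 0
    (Complex.exp (-(Complex.I * x * lam)) • 1)

theorem hasDerivAt_cexp_mul_ofReal (c : ℂ) (x : ℝ) :
    HasDerivAt (fun t : ℝ => Complex.exp (c * t)) (c * Complex.exp (c * x)) x := by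
  have h1 : HasDerivAt (fun t : ℝ => c * (t : ℂ)) (c * 1) x :=
    (Complex.ofRealCLM.hasDerivAt (x := x)).const_mul c
  have h2 := h1.cexp
  rwa [mul_one, mul_comm] at h2

theorem hasMatDerivWithinAt_phase {s : Set ℝ} {x : ℝ} :
    HasMatDerivWithinAt (phase m₁ m₂ lam)
      ((Complex.I * lam) • (jMat m₁ m₂ * phase m₁ m₂ lam x)) s x := by
  have e1 : ∀ t : ℝ, Complex.I * t * lam = Complex.I * lam * t := fun t => by ring
  have e2 : ∀ t : ℝ, -(Complex.I * t * lam) = -(Complex.I * lam) * t := fun t => by ring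
  have h1 := hasDerivAt_cexp_mul_ofReal (Complex.I * lam) x
  have h2 := hasDerivAt_cexp_mul_ofReal (-(Complex.I * lam)) x
  simp only [← e1] at h1
  simp only [← e2] at h2
  rw [phase, jMat, Matrix.fromBlocks_multiply, Matrix.fromBlocks_smul]
  rintro (p | p) (q | q)
  · refine ((h1.mul_const ((1 : Matrix (Fin m₁) (Fin m₁) ℂ) p q)).congr_deriv ?_).hasDerivWithinAt
    simp [mul_assoc]
  · exact ((hasDerivAt_const x (0 : ℂ)).congr_deriv (by simp)).hasDerivWithinAt
  · exact ((hasDerivAt_const x (0 : ℂ)).congr_deriv (by simp)).hasDerivWithinAt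
  · refine ((h2.mul_const ((1 : Matrix (Fin m₂) (Fin m₂) ℂ) p q)).congr_deriv ?_).hasDerivWithinAt
    simp [mul_assoc]

theorem phase_zero : phase m₁ m₂ lam 0 = 1 := by
  simp [phase]

theorem det_phase_ne_zero (x : ℝ) : (phase m₁ m₂ lam x).det ≠ 0 := by
  refine Matrix.det_ne_zero_of_right_inverse (B := phase m₁ m₂ lam (-x)) ?_
  simp [phase, Matrix.fromBlocks_multiply, smul_smul, ← Complex.exp_add]

variable (α S₀ γ₁ γ) in
/-- The fundamental solution `w(x, λ) e^{ixλj}`. -/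
def fundamental (lam x : ℝ) : Matrix (Fin m₁ ⊕ Fin m₂) (Fin m₁ ⊕ Fin m₂) ℂ :=
  darboux α S₀ γ₁ γ lam x * phase m₁ m₂ lam x

theorem hasMatDerivWithinAt_fundamental (hv : DeterminedBy v α S₀ γ₁ γ)
    (hlam : (lam : ℂ) ∉ spectrum ℂ α) {s : Set ℝ} {x : ℝ}
    (hx : 0 ≤ x) (hs : x ∉ singularSet α S₀ γ₁ γ) :
    HasMatDerivWithinAt (fundamental α S₀ γ₁ γ lam)
      (Complex.I • ((lam : ℂ) • jMat m₁ m₂ + jMat m₁ m₂ * VMat (v x)) *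
        fundamental α S₀ γ₁ γ lam x) s x := by
  refine ((hasMatDerivWithinAt_darboux hv hlam hx hs).mul
    hasMatDerivWithinAt_phase).congr_deriv ?_
  rw [fundamental]
  set w := darboux α S₀ γ₁ γ lam x
  simp only [Matrix.add_mul, Matrix.sub_mul, Matrix.smul_mul, Matrix.mul_smul, Matrix.mul_assoc,
    smul_add, smul_sub, smul_smul]
  abel

theorem det_darboux_ne_zero (h : Admissible α S₀ γ₁ γ) (hlam : (lam : ℂ) ∉ spectrum ℂ α) {x : ℝ}
    (hs : (SMat α S₀ γ₁ γ x).det ≠ 0) : (darboux α S₀ γ₁ γ lam x).det ≠ 0 := by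
  refine Matrix.det_ne_zero_of_left_inverse
    (B := jMat m₁ m₂ * (darboux α S₀ γ₁ γ lam x)ᴴ * jMat m₁ m₂) ?_
  rw [Matrix.mul_assoc, Matrix.mul_assoc, darboux_conjTranspose_mul_jMat_mul h hlam hs,
    jMat_mul_self]

theorem det_fundamental_ne_zero (h : Admissible α S₀ γ₁ γ) (hlam : (lam : ℂ) ∉ spectrum ℂ α)
    {x : ℝ} (hs : (SMat α S₀ γ₁ γ x).det ≠ 0) : (fundamental α S₀ γ₁ γ lam x).det ≠ 0 := by
  rw [fundamental, Matrix.det_mul]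
  exact mul_ne_zero (det_darboux_ne_zero h hlam hs) (det_phase_ne_zero x)

theorem meromorphicAt_cexp (c : ℂ) (x : ℝ) :
    MeromorphicAt (fun t : ℝ => Complex.exp (c * t)) x := by
  have h1 : AnalyticAt ℝ Complex.exp (c * (x : ℂ)) :=
    AnalyticAt.restrictScalars (𝕜 := ℝ) (𝕜' := ℂ) (by fun_prop)
  have h2 : AnalyticAt ℝ (fun t : ℝ => c * (t : ℂ)) x :=
    analyticAt_const.mul (Complex.ofRealCLM.analyticAt x)
  exact (AnalyticAt.comp (f := fun t : ℝ => c * (t : ℂ)) h1 h2).meromorphicAt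

theorem meromorphicAt_phase (x : ℝ) (p q : Fin m₁ ⊕ Fin m₂) :
    MeromorphicAt (fun t => phase m₁ m₂ lam t p q) x := by
  have e1 : ∀ t : ℝ, Complex.I * t * lam = Complex.I * lam * t := fun t => by ring
  have e2 : ∀ t : ℝ, -(Complex.I * t * lam) = -(Complex.I * lam) * t := fun t => by ring
  have h1 := meromorphicAt_cexp (Complex.I * lam) x
  have h2 := meromorphicAt_cexp (-(Complex.I * lam)) x
  simp only [← e1] at h1
  simp only [← e2] at h2
  rcases p with p | p <;> rcases q with q | q
  · exact h1.fun_mul (MeromorphicAt.const ((1 : Matrix (Fin m₁) (Fin m₁) ℂ) p q) x)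
  · exact MeromorphicAt.const 0 x
  · exact MeromorphicAt.const 0 x
  · exact h2.fun_mul (MeromorphicAt.const ((1 : Matrix (Fin m₂) (Fin m₂) ℂ) p q) x)

theorem meromorphicAt_Lam (x : ℝ) (p : Fin n) (q : Fin m₁ ⊕ Fin m₂) :
    MeromorphicAt (fun t => Lam α γ₁ γ t p q) x := by
  rcases q with q | q
  · have h1 := meromorphicAt_mexp_entry α (-Complex.I) x
    simp only [neg_mul] at h1
    exact meromorphicAt_matrix_mul h1 (fun p q => MeromorphicAt.const (γ₁ p q) x) p q
  · exact meromorphicAt_matrix_mul (meromorphicAt_mexp_entry α Complex.I x)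
      (fun p q => MeromorphicAt.const (γ p q) x) p q

theorem meromorphicAt_Lam_conjTranspose (x : ℝ) (p : Fin m₁ ⊕ Fin m₂) (q : Fin n) :
    MeromorphicAt (fun t => (Lam α γ₁ γ t)ᴴ p q) x := by
  simp only [Lam, Matrix.conjTranspose_fromCols_eq_fromRows_conjTranspose,
    Matrix.conjTranspose_mul, conjTranspose_mexp_I, conjTranspose_mexp_neg_I]
  rcases p with p | p
  · exact meromorphicAt_matrix_mul (fun p q => MeromorphicAt.const (γ₁ᴴ p q) x)
      (meromorphicAt_mexp_entry αᴴ Complex.I x) p q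
  · have h1 := meromorphicAt_mexp_entry αᴴ (-Complex.I) x
    simp only [neg_mul] at h1
    exact meromorphicAt_matrix_mul (fun p q => MeromorphicAt.const (γᴴ p q) x) h1 p q

theorem meromorphicAt_fundamental (h : Admissible α S₀ γ₁ γ) (x : ℝ) (p q : Fin m₁ ⊕ Fin m₂) :
    MeromorphicAt (fun t => fundamental α S₀ γ₁ γ lam t p q) x := by
  refine meromorphicAt_matrix_mul (fun p q => ?_) (meromorphicAt_phase x) p q
  refine (MeromorphicAt.const ((1 : Matrix (Fin m₁ ⊕ Fin m₂) (Fin m₁ ⊕ Fin m₂) ℂ) p q) x).fun_add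
    ((MeromorphicAt.const Complex.I x).fun_mul ?_)
  exact meromorphicAt_matrix_mul (fun p q => MeromorphicAt.const (jMat m₁ m₂ p q) x)
    (meromorphicAt_matrix_mul (meromorphicAt_Lam_conjTranspose x)
      (meromorphicAt_matrix_mul (meromorphicAt_matrix_inv (meromorphicAt_SMat h.identity x))
        (meromorphicAt_matrix_mul (fun p q => MeromorphicAt.const (res lam α p q) x)
          (meromorphicAt_Lam x)))) p q

theorem isClosed_singularSet : IsClosed (singularSet α S₀ γ₁ γ) := by
  refine isClosed_singleton.preimage (f := fun x => (SMat α S₀ γ₁ γ x).det) ?_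
  refine continuous_iff_continuousAt.2 fun x => ?_
  have h1 := (hasMatDerivWithinAt_SMat (s := Set.univ) (x := x) α S₀ γ₁ γ).tendsto
  rw [nhdsWithin_univ] at h1
  exact tendsto_matrix_det h1

theorem isSolution_fundamental_mul (hv : DeterminedBy v α S₀ γ₁ γ)
    (hlam : (lam : ℂ) ∉ spectrum ℂ α) {k : ℕ} (C : Matrix (Fin m₁ ⊕ Fin m₂) (Fin k) ℂ) :
    IsSolution v (singularSet α S₀ γ₁ γ) lam fun x => fundamental α S₀ γ₁ γ lam x * C where
  meromorphic p q := fun x _ => meromorphicAt_matrix_mul (meromorphicAt_fundamental hv.admissible x)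
    (fun p q => MeromorphicAt.const (C p q) x) p q
  equation x hx hs := by
    refine ((hasMatDerivWithinAt_fundamental hv hlam hx hs).mul_const C).congr_deriv ?_
    simp only [Matrix.smul_mul, Matrix.mul_assoc]

theorem IsSolution.eq_fundamental_mul (hv : DeterminedBy v α S₀ γ₁ γ) (hS₀ : S₀.det ≠ 0)
    (hlam : (lam : ℂ) ∉ spectrum ℂ α) {k : ℕ} {u : ℝ → Matrix (Fin m₁ ⊕ Fin m₂) (Fin k) ℂ}
    (hu : IsSolution v (singularSet α S₀ γ₁ γ) lam u) {x : ℝ} (hx : 0 ≤ x)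
    (hs : x ∉ singularSet α S₀ γ₁ γ) :
    u x = fundamental α S₀ γ₁ γ lam x * ((darboux α S₀ γ₁ γ lam 0)⁻¹ * u 0) := by
  have h0 : (0 : ℝ) ∉ singularSet α S₀ γ₁ γ := by simpa [singularSet, SMat_zero] using hS₀
  have := DiracPE.eq_fundamental_mul isClosed_singularSet h0
    (fun x hx hs => hasMatDerivWithinAt_fundamental hv hlam hx hs)
    (fun x _ hs => det_fundamental_ne_zero hv.admissible hlam hs)
    (fun x _ => meromorphicAt_fundamental hv.admissible x)
    (fun x hx hs => HasMatDerivWithinAt.congr_deriv (hu.equation x hx hs)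
      (by rw [Matrix.smul_mul]))
    (fun x hx p q => hu.meromorphic p q x hx) hx hs
  rwa [fundamental, fundamental, phase_zero, Matrix.mul_one] at this

end Fundamental

/-! ### Asymptotics at infinity -/

section Asymptotics

variable {n m₁ m₂ : ℕ} {α S₀ : Matrix (Fin n) (Fin n) ℂ} {γ₁ : Matrix (Fin n) (Fin m₁) ℂ}
  {γ : Matrix (Fin n) (Fin m₂) ℂ} {lam : ℝ}

theorem darboux_eq_fromBlocks (x : ℝ) (T : Matrix (Fin n) (Fin n) ℂ)
    (hT : (SMat α S₀ γ₁ γ x)⁻¹ = T) :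
    darboux α S₀ γ₁ γ lam x = Matrix.fromBlocks
      (1 + Complex.I • ((mexp (-(Complex.I * x)) α * γ₁)ᴴ * T * res lam α *
        (mexp (-(Complex.I * x)) α * γ₁)))
      (Complex.I • ((mexp (-(Complex.I * x)) α * γ₁)ᴴ * T * res lam α *
        (mexp (Complex.I * x) α * γ)))
      (-(Complex.I • ((mexp (Complex.I * x) α * γ)ᴴ * T * res lam α *
        (mexp (-(Complex.I * x)) α * γ₁))))
      (1 - Complex.I • ((mexp (Complex.I * x) α * γ)ᴴ * T * res lam α *
        (mexp (Complex.I * x) α * γ))) := by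
  rw [darboux, hT, ← Matrix.mul_assoc, ← Matrix.mul_assoc, ← Matrix.mul_assoc, Lam,
    Matrix.conjTranspose_fromCols_eq_fromRows_conjTranspose, jMat, Matrix.fromBlocks_mul_fromRows,
    Matrix.fromRows_mul, Matrix.fromRows_mul, Matrix.fromRows_mul_fromCols, Matrix.fromBlocks_smul,
    ← Matrix.fromBlocks_one, Matrix.fromBlocks_add]
  simp [sub_eq_add_neg]

theorem darboux_zero : darboux α S₀ γ₁ γ lam 0 = Matrix.fromBlocks
      (1 + Complex.I • (γ₁ᴴ * S₀⁻¹ * res lam α * γ₁))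
      (Complex.I • (γ₁ᴴ * S₀⁻¹ * res lam α * γ))
      (-(Complex.I • (γᴴ * S₀⁻¹ * res lam α * γ₁)))
      (1 - Complex.I • (γᴴ * S₀⁻¹ * res lam α * γ)) := by
  rw [darboux_eq_fromBlocks 0 S₀⁻¹ (by rw [SMat_zero])]
  simp [mexp_zero]

theorem commute_res (A : Matrix (Fin n) (Fin n) ℂ) (lam : ℝ) : Commute A (res lam A) := by
  by_cases h : (lam : ℂ) ∈ spectrum ℂ A
  -- At a spectral point the total inverse is zero, so commutation needs no hypothesis on `lam`.
  · have : res lam A = 0 := by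
      rw [res]
      refine Matrix.nonsing_inv_apply_not_isUnit _ ?_
      have := (not_iff_not.2 (mem_spectrum_iff (A := A) (lam := lam))).1 (not_not.2 h)
      rwa [isUnit_iff_ne_zero]
    rw [this]
    exact Commute.zero_right A
  · rw [Commute, SemiconjBy, mul_res_eq h, res_mul_eq h]

/-- In each block `S⁻¹` is rewritten through `Q⁻¹` or `R⁻¹`, whichever makes the exponentials
cancel; in the off-diagonal blocks they combine into `R⁻¹ e^{-2ixα}` or its adjoint. Every factor
then has a known limit. -/
theorem darboux_eq_fromBlocks_RMat (x : ℝ) :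
    darboux α S₀ γ₁ γ lam x = Matrix.fromBlocks
      (1 + Complex.I • (γ₁ᴴ * ((QMat α S₀ γ₁ γ x)⁻¹ * (res lam α * γ₁))))
      (Complex.I • (γ₁ᴴ * ((mexp (-(2 * (Complex.I * x))) α)ᴴ * (RMat α S₀ γ₁ γ x)⁻¹ *
        (res lam α * γ))))
      (-(Complex.I • (γᴴ * ((RMat α S₀ γ₁ γ x)⁻¹ * mexp (-(2 * (Complex.I * x))) α *
        (res lam α * γ₁)))))
      (1 - Complex.I • (γᴴ * ((RMat α S₀ γ₁ γ x)⁻¹ * (res lam α * γ)))) := by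
  set E := mexp (Complex.I * x) α with hE
  set F := mexp (-(Complex.I * x)) α with hF
  have hEF : E * F = 1 := mexp_mul_mexp_neg α _
  have hFE : F * E = 1 := mexp_neg_mul_mexp α _
  have hFE' : Fᴴ * Eᴴ = 1 := by rw [← Matrix.conjTranspose_mul, hEF, Matrix.conjTranspose_one]
  have hEF' : Eᴴ * Fᴴ = 1 := by rw [← Matrix.conjTranspose_mul, hFE, Matrix.conjTranspose_one]
  have hEr : E * res lam α = res lam α * E := mexp_comm α _ (commute_res α lam)
  have hFr : F * res lam α = res lam α * F := mexp_comm α _ (commute_res α lam)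
  have e11 : (F * γ₁)ᴴ * (SMat α S₀ γ₁ γ x)⁻¹ * res lam α * (F * γ₁) =
      γ₁ᴴ * ((QMat α S₀ γ₁ γ x)⁻¹ * (res lam α * γ₁)) := by
    rw [inv_SMat_eq_QMat]
    calc _ = γ₁ᴴ * ((Fᴴ * Eᴴ) * ((QMat α S₀ γ₁ γ x)⁻¹ * ((E * res lam α) * (F * γ₁)))) := by
          simp only [Matrix.conjTranspose_mul, Matrix.mul_assoc, hE]
      _ = γ₁ᴴ * ((Fᴴ * Eᴴ) * ((QMat α S₀ γ₁ γ x)⁻¹ * (res lam α * ((E * F) * γ₁)))) := by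
          rw [hEr]; simp only [Matrix.mul_assoc]
      _ = _ := by rw [hFE', hEF, Matrix.one_mul, Matrix.one_mul]
  have e12 : (F * γ₁)ᴴ * (SMat α S₀ γ₁ γ x)⁻¹ * res lam α * (E * γ) =
      γ₁ᴴ * ((mexp (-(2 * (Complex.I * x))) α)ᴴ * (RMat α S₀ γ₁ γ x)⁻¹ * (res lam α * γ)) := by
    rw [inv_SMat_eq_RMat, ← mexp_neg_I_sq]
    calc _ = γ₁ᴴ * (Fᴴ * (Fᴴ * ((RMat α S₀ γ₁ γ x)⁻¹ * ((F * res lam α) * (E * γ))))) := by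
          simp only [Matrix.conjTranspose_mul, Matrix.mul_assoc, hF]
      _ = γ₁ᴴ * (Fᴴ * (Fᴴ * ((RMat α S₀ γ₁ γ x)⁻¹ * (res lam α * ((F * E) * γ))))) := by
          rw [hFr]; simp only [Matrix.mul_assoc]
      _ = _ := by
          rw [hFE, Matrix.one_mul]
          simp only [Matrix.conjTranspose_mul, Matrix.mul_assoc, hF]
  have e21 : (E * γ)ᴴ * (SMat α S₀ γ₁ γ x)⁻¹ * res lam α * (F * γ₁) =
      γᴴ * ((RMat α S₀ γ₁ γ x)⁻¹ * mexp (-(2 * (Complex.I * x))) α * (res lam α * γ₁)) := by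
    rw [inv_SMat_eq_RMat, ← mexp_neg_I_sq]
    calc _ = γᴴ * ((Eᴴ * Fᴴ) * ((RMat α S₀ γ₁ γ x)⁻¹ * (F * ((res lam α * F) * γ₁)))) := by
          simp only [Matrix.conjTranspose_mul, Matrix.mul_assoc, hF]
      _ = _ := by
          rw [hEF', Matrix.one_mul, ← hFr]
          simp only [Matrix.mul_assoc, hF]
  have e22 : (E * γ)ᴴ * (SMat α S₀ γ₁ γ x)⁻¹ * res lam α * (E * γ) =
      γᴴ * ((RMat α S₀ γ₁ γ x)⁻¹ * (res lam α * γ)) := by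
    rw [inv_SMat_eq_RMat]
    calc _ = γᴴ * ((Eᴴ * Fᴴ) * ((RMat α S₀ γ₁ γ x)⁻¹ * ((F * res lam α) * (E * γ)))) := by
          simp only [Matrix.conjTranspose_mul, Matrix.mul_assoc, hF]
      _ = γᴴ * ((Eᴴ * Fᴴ) * ((RMat α S₀ γ₁ γ x)⁻¹ * (res lam α * ((F * E) * γ)))) := by
          rw [hFr]; simp only [Matrix.mul_assoc]
      _ = _ := by rw [hEF', hFE, Matrix.one_mul, Matrix.one_mul]
  rw [darboux_eq_fromBlocks x _ rfl, e11, e12, e21, e22]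

variable {κ : Matrix (Fin n) (Fin n) ℂ}

theorem tendsto_darboux (h : Admissible α S₀ γ₁ γ)
    (hκ : Tendsto (fun x => (RMat α S₀ γ₁ γ x)⁻¹) atTop (𝓝 κ)) :
    Tendsto (fun x => darboux α S₀ γ₁ γ lam x) atTop
      (𝓝 (Matrix.fromBlocks 1 0 0 (1 - Complex.I • (γᴴ * (κ * (res lam α * γ)))))) := by
  have hN := tendsto_inv_RMat_mul_mexp h
  have hN' := tendsto_matrix_conjTranspose hN
  have hR := fun x => (RMat_isHermitian (α := α) (γ₁ := γ₁) (γ := γ) h.hermitian x).inv.eq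
  simp only [Matrix.conjTranspose_mul, hR, Matrix.conjTranspose_zero] at hN'
  have t11 := (tendsto_const_nhds (x := (1 : Matrix (Fin m₁) (Fin m₁) ℂ))).add
    ((tendsto_matrix_mul (tendsto_const_nhds (x := γ₁ᴴ)) (tendsto_matrix_mul (tendsto_inv_QMat h)
      (tendsto_const_nhds (x := res lam α * γ₁)))).const_smul Complex.I)
  have t12 := (tendsto_matrix_mul (tendsto_const_nhds (x := γ₁ᴴ)) (tendsto_matrix_mul hN'
      (tendsto_const_nhds (x := res lam α * γ)))).const_smul Complex.I
  have t21 := ((tendsto_matrix_mul (tendsto_const_nhds (x := γᴴ)) (tendsto_matrix_mul hN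
      (tendsto_const_nhds (x := res lam α * γ₁)))).const_smul Complex.I).neg
  have t22 := (tendsto_const_nhds (x := (1 : Matrix (Fin m₂) (Fin m₂) ℂ))).sub
    ((tendsto_matrix_mul (tendsto_const_nhds (x := γᴴ)) (tendsto_matrix_mul hκ
      (tendsto_const_nhds (x := res lam α * γ)))).const_smul Complex.I)
  simp only [Matrix.zero_mul, Matrix.mul_zero, smul_zero, add_zero, neg_zero] at t11 t12 t21
  rw [funext darboux_eq_fromBlocks_RMat, tendsto_matrix_iff]
  rintro (p | p) (q | q)
  · exact tendsto_matrix_iff.1 t11 p q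
  · exact tendsto_matrix_iff.1 t12 p q
  · exact tendsto_matrix_iff.1 t21 p q
  · exact tendsto_matrix_iff.1 t22 p q

theorem tendsto_smul_zero {ι' κ' τ : Type*} {l : Filter τ} {e : τ → ℂ} (he : ∀ x, ‖e x‖ = 1)
    {F : τ → Matrix ι' κ' ℂ} (hF : Tendsto F l (𝓝 0)) :
    Tendsto (fun x => e x • F x) l (𝓝 0) := by
  rw [tendsto_matrix_iff] at *
  intro p q
  have := hF p q
  rw [Matrix.zero_apply, tendsto_zero_iff_norm_tendsto_zero] at *
  simpa [he] using this

theorem norm_cexp_I_mul (x : ℝ) : ‖Complex.exp (Complex.I * x * lam)‖ = 1 := by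
  rw [Complex.norm_exp]; simp

theorem norm_cexp_neg_I_mul (x : ℝ) : ‖Complex.exp (-(Complex.I * x * lam))‖ = 1 := by
  rw [Complex.norm_exp]; simp

theorem cexp_neg_mul_cexp (z : ℂ) : Complex.exp (-z) * Complex.exp z = 1 := by
  rw [← Complex.exp_add, neg_add_cancel, Complex.exp_zero]

/-- Both halves of a matrix of solutions behave like free solutions at infinity. -/
theorem tendsto_fundamental_mul {w : ℝ → Matrix (Fin m₁ ⊕ Fin m₂) (Fin m₁ ⊕ Fin m₂) ℂ}
    {D : Matrix (Fin m₂) (Fin m₂) ℂ} (hw : Tendsto w atTop (𝓝 (Matrix.fromBlocks 1 0 0 D)))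
    {k : ℕ} (C : Matrix (Fin m₁ ⊕ Fin m₂) (Fin k) ℂ) :
    Tendsto (fun x : ℝ => Complex.exp (-(Complex.I * x * lam)) •
        (w x * phase m₁ m₂ lam x * C).toRows₁) atTop (𝓝 C.toRows₁) ∧
      Tendsto (fun x : ℝ => Complex.exp (Complex.I * x * lam) •
        (w x * phase m₁ m₂ lam x * C).toRows₂) atTop (𝓝 (D * C.toRows₂)) := by
  have hb := fun x => Matrix.fromBlocks_toBlocks (w x)
  have t11 : Tendsto (fun x => (w x).toBlocks₁₁) atTop (𝓝 1) :=
    tendsto_matrix_iff.2 fun p q => tendsto_matrix_iff.1 hw (Sum.inl p) (Sum.inl q)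
  have t12 : Tendsto (fun x => (w x).toBlocks₁₂) atTop (𝓝 0) :=
    tendsto_matrix_iff.2 fun p q => tendsto_matrix_iff.1 hw (Sum.inl p) (Sum.inr q)
  have t21 : Tendsto (fun x => (w x).toBlocks₂₁) atTop (𝓝 0) :=
    tendsto_matrix_iff.2 fun p q => tendsto_matrix_iff.1 hw (Sum.inr p) (Sum.inl q)
  have t22 : Tendsto (fun x => (w x).toBlocks₂₂) atTop (𝓝 D) :=
    tendsto_matrix_iff.2 fun p q => tendsto_matrix_iff.1 hw (Sum.inr p) (Sum.inr q)
  have hmul : ∀ x : ℝ, w x * phase m₁ m₂ lam x * C = Matrix.fromRows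
      (Complex.exp (Complex.I * x * lam) • ((w x).toBlocks₁₁ * C.toRows₁) +
        Complex.exp (-(Complex.I * x * lam)) • ((w x).toBlocks₁₂ * C.toRows₂))
      (Complex.exp (Complex.I * x * lam) • ((w x).toBlocks₂₁ * C.toRows₁) +
        Complex.exp (-(Complex.I * x * lam)) • ((w x).toBlocks₂₂ * C.toRows₂)) := fun x => by
    conv_lhs => rw [← hb x, ← Matrix.fromRows_toRows C, phase, Matrix.fromBlocks_multiply,
      Matrix.fromBlocks_mul_fromRows]
    simp
  -- The off-diagonal terms carry the phase `e^{∓2ixλ}`, unimodular for real `λ`, so they vanish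
  -- with the blocks of `w`.
  have s12 := tendsto_smul_zero (norm_cexp_neg_I_mul (lam := lam)) (tendsto_smul_zero
    (norm_cexp_neg_I_mul (lam := lam)) (by
      simpa using tendsto_matrix_mul t12 (tendsto_const_nhds (x := C.toRows₂))))
  have s21 := tendsto_smul_zero (norm_cexp_I_mul (lam := lam)) (tendsto_smul_zero
    (norm_cexp_I_mul (lam := lam)) (by
      simpa using tendsto_matrix_mul t21 (tendsto_const_nhds (x := C.toRows₁))))
  have s11 := tendsto_matrix_mul t11 (tendsto_const_nhds (x := C.toRows₁))
  have s22 := tendsto_matrix_mul t22 (tendsto_const_nhds (x := C.toRows₂))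
  constructor
  · have := s11.add s12
    rw [Matrix.one_mul, add_zero] at this
    refine this.congr fun x => ?_
    rw [hmul, Matrix.toRows₁_fromRows]
    simp only [smul_add, smul_smul, cexp_neg_mul_cexp, one_smul]
  · have := s21.add s22
    rw [zero_add] at this
    refine this.congr fun x => ?_
    rw [hmul, Matrix.toRows₂_fromRows, smul_add, smul_smul _ (Complex.exp (-(Complex.I * x * lam))),
      mul_comm _ (Complex.exp (-(Complex.I * x * lam))), cexp_neg_mul_cexp, one_smul]

/-- Multiplication by unimodular phases preserves convergence to zero, so the asymptotic condition
on `Y` splits into the normalized limits of its two row blocks. -/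
theorem tendsto_sub_free_iff {k : ℕ} {u : ℝ → Matrix (Fin m₁ ⊕ Fin m₂) (Fin k) ℂ}
    {A : Matrix (Fin m₁) (Fin k) ℂ} :
    Tendsto (fun x : ℝ => u x - Complex.exp (Complex.I * x * lam) • Matrix.fromRows A 0)
        atTop (𝓝 0) ↔
      Tendsto (fun x : ℝ => Complex.exp (-(Complex.I * x * lam)) • (u x).toRows₁) atTop (𝓝 A) ∧
      Tendsto (fun x : ℝ => Complex.exp (Complex.I * x * lam) • (u x).toRows₂) atTop (𝓝 0) := by
  have hsplit : ∀ {F : ℝ → Matrix (Fin m₁ ⊕ Fin m₂) (Fin k) ℂ}, Tendsto F atTop (𝓝 0) ↔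
      Tendsto (fun x => (F x).toRows₁) atTop (𝓝 0) ∧
        Tendsto (fun x => (F x).toRows₂) atTop (𝓝 0) := by
    intro F
    simp only [tendsto_matrix_iff]
    exact ⟨fun h => ⟨fun p q => h (Sum.inl p) q, fun p q => h (Sum.inr p) q⟩,
      fun h p q => by cases p with
        | inl p => exact h.1 p q
        | inr p => exact h.2 p q⟩
  rw [hsplit]
  refine and_congr ⟨fun h => ?_, fun h => ?_⟩ ⟨fun h => ?_, fun h => ?_⟩
  · have := (tendsto_smul_zero (norm_cexp_neg_I_mul (lam := lam)) h).add_const A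
    rw [zero_add] at this
    refine this.congr fun x => ?_
    have : (u x - Complex.exp (Complex.I * x * lam) • Matrix.fromRows A 0).toRows₁ =
      (u x).toRows₁ - Complex.exp (Complex.I * x * lam) • A := rfl
    rw [this, smul_sub, smul_smul, cexp_neg_mul_cexp, one_smul, sub_add_cancel]
  · have := tendsto_smul_zero (norm_cexp_I_mul (lam := lam)) (by simpa using h.sub_const A)
    refine this.congr fun x => ?_
    rw [smul_sub, smul_smul, mul_comm, cexp_neg_mul_cexp, one_smul]
    rfl
  · refine tendsto_smul_zero (norm_cexp_I_mul (lam := lam)) (h.congr fun x => ?_)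
    ext p q
    simp [Matrix.toRows₂]
  · refine (tendsto_smul_zero (norm_cexp_neg_I_mul (lam := lam)) h).congr fun x => ?_
    rw [smul_smul, cexp_neg_mul_cexp, one_smul]
    ext p q
    simp [Matrix.toRows₂]

end Asymptotics

/-! ### Scattering coefficients -/

section Scattering

variable {n m₁ m₂ : ℕ} {α S₀ : Matrix (Fin n) (Fin n) ℂ} {γ₁ : Matrix (Fin n) (Fin m₁) ℂ}
  {γ : Matrix (Fin n) (Fin m₂) ℂ} {lam : ℝ} {κ : Matrix (Fin n) (Fin n) ℂ}
  {v : ℝ → Matrix (Fin m₁) (Fin m₂) ℂ}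

theorem blocks_of_conjTranspose_mul_jMat_mul {a : Matrix (Fin m₁) (Fin m₁) ℂ}
    {b : Matrix (Fin m₁) (Fin m₂) ℂ} {c : Matrix (Fin m₂) (Fin m₁) ℂ} {d : Matrix (Fin m₂) (Fin m₂) ℂ}
    (h : (Matrix.fromBlocks a b c d)ᴴ * (jMat m₁ m₂ * Matrix.fromBlocks a b c d) = jMat m₁ m₂) :
    aᴴ * a = 1 + cᴴ * c ∧ dᴴ * d = 1 + bᴴ * b := by
  rw [Matrix.fromBlocks_conjTranspose, jMat, Matrix.fromBlocks_multiply, Matrix.fromBlocks_multiply,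
    Matrix.fromBlocks_inj] at h
  obtain ⟨h1, -, -, h4⟩ := h
  simp only [Matrix.one_mul, Matrix.zero_mul, add_zero, zero_add, Matrix.neg_mul,
    Matrix.mul_neg] at h1 h4
  constructor
  · rw [← h1]; abel
  · rw [← neg_neg (1 : Matrix (Fin m₂) (Fin m₂) ℂ), ← h4]
    abel

/-- The form of `a^* a` dominates that of the identity, so `a` has trivial kernel. -/
theorem isUnit_of_conjTranspose_mul_self_eq {k l : ℕ} {a : Matrix (Fin k) (Fin k) ℂ}
    {c : Matrix (Fin l) (Fin k) ℂ} (h : aᴴ * a = 1 + cᴴ * c) : a.det ≠ 0 := by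
  have h1 : (aᴴ * a).det ≠ 0 := by
    refine det_ne_zero_of_le_qf one_pos fun f => ?_
    have h2 := qf_mul_conjTranspose_nonneg cᴴ f
    rw [Matrix.conjTranspose_conjTranspose] at h2
    rw [h, qf_add_matrix]
    linarith
  rw [Matrix.det_mul] at h1
  exact right_ne_zero_of_mul h1

theorem blocks_darboux_zero (h : Admissible α S₀ γ₁ γ) (hS₀ : S₀.det ≠ 0)
    (hlam : (lam : ℂ) ∉ spectrum ℂ α) :
    (1 + Complex.I • (γ₁ᴴ * S₀⁻¹ * res lam α * γ₁)).det ≠ 0 ∧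
      (1 - Complex.I • (γᴴ * S₀⁻¹ * res lam α * γ)).det ≠ 0 := by
  have h1 := darboux_conjTranspose_mul_jMat_mul h hlam (x := 0) (by rwa [SMat_zero])
  rw [darboux_zero] at h1
  have h2 := blocks_of_conjTranspose_mul_jMat_mul h1
  exact ⟨isUnit_of_conjTranspose_mul_self_eq h2.1, isUnit_of_conjTranspose_mul_self_eq h2.2⟩

/-- Factor `λ - θ = (λ - α)(1 + i(λ - α)⁻¹ γ₁ γ₁^* S₀⁻¹)`. By Sylvester's determinant identity the
second factor has the determinant of the upper left block of `w(0, λ)`, which is nonzero by `w^* j w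
= j`. -/
theorem notMem_spectrum_theta (h : Admissible α S₀ γ₁ γ) (hS₀ : S₀.det ≠ 0)
    (hlam : (lam : ℂ) ∉ spectrum ℂ α) : (lam : ℂ) ∉ spectrum ℂ (theta α S₀ γ₁) := by
  rw [mem_spectrum_iff]
  have e : (lam : ℂ) • (1 : Matrix (Fin n) (Fin n) ℂ) - theta α S₀ γ₁ =
      ((lam : ℂ) • 1 - α) * (1 + (Complex.I • (res lam α * γ₁)) * (γ₁ᴴ * S₀⁻¹)) := by
    have e0 : ((lam : ℂ) • 1 - α) * (res lam α * γ₁ * (γ₁ᴴ * S₀⁻¹)) = γ₁ * (γ₁ᴴ * S₀⁻¹) := by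
      rw [Matrix.mul_assoc, ← Matrix.mul_assoc, mul_res hlam, Matrix.one_mul]
    rw [Matrix.mul_add, Matrix.mul_one, Matrix.smul_mul, Matrix.mul_smul, e0, theta,
      Matrix.mul_assoc]
    abel
  rw [e, Matrix.det_mul, Matrix.det_one_add_mul_comm]
  refine mul_ne_zero (mem_spectrum_iff.1 hlam) ?_
  rw [Matrix.mul_smul, ← Matrix.mul_assoc]
  exact (blocks_darboux_zero h hS₀ hlam).1

theorem notMem_spectrum_conjTranspose (hlam : (lam : ℂ) ∉ spectrum ℂ α) :
    (lam : ℂ) ∉ spectrum ℂ αᴴ := by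
  have h1 : spectrum ℂ (star α) = star (spectrum ℂ α) := spectrum.map_star α
  rw [← Matrix.star_eq_conjTranspose, h1, Set.mem_star]
  simpa using hlam

/-- The second resolvent identity; multiplied by `γ₁^* S₀⁻¹` or `γ^* S₀⁻¹` on the left and `γ₁` on
the right, it gives `inv_leftBlock` and `leftReflection_eq`. -/
theorem res_sub_res_theta (hlam : (lam : ℂ) ∉ spectrum ℂ α)
    (hθ : (lam : ℂ) ∉ spectrum ℂ (theta α S₀ γ₁)) :
    res lam α - res lam (theta α S₀ γ₁) =
      Complex.I • (res lam α * (γ₁ * (γ₁ᴴ * (S₀⁻¹ * res lam (theta α S₀ γ₁))))) := by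
  have e : Complex.I • (γ₁ * (γ₁ᴴ * S₀⁻¹)) =
      ((lam : ℂ) • (1 : Matrix (Fin n) (Fin n) ℂ) - theta α S₀ γ₁) - ((lam : ℂ) • 1 - α) := by
    rw [theta, Matrix.mul_assoc]; abel
  calc res lam α - res lam (theta α S₀ γ₁)
      = res lam α * (Complex.I • (γ₁ * (γ₁ᴴ * S₀⁻¹))) * res lam (theta α S₀ γ₁) := by
        rw [e, Matrix.mul_sub, Matrix.sub_mul, Matrix.mul_assoc, mul_res hθ, Matrix.mul_one,
          res_mul hlam, Matrix.one_mul]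
    _ = _ := by simp only [Matrix.mul_smul, Matrix.smul_mul, Matrix.mul_assoc]

theorem inv_leftBlock (hlam : (lam : ℂ) ∉ spectrum ℂ α)
    (hθ : (lam : ℂ) ∉ spectrum ℂ (theta α S₀ γ₁)) :
    (1 + Complex.I • (γ₁ᴴ * S₀⁻¹ * res lam α * γ₁))⁻¹ =
      1 - Complex.I • (γ₁ᴴ * S₀⁻¹ * res lam (theta α S₀ γ₁) * γ₁) := by
  refine Matrix.inv_eq_right_inv ?_
  have e := congrArg (fun M => γ₁ᴴ * S₀⁻¹ * M * γ₁) (res_sub_res_theta hlam hθ)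
  simp only [Matrix.mul_sub, Matrix.sub_mul, Matrix.mul_smul, Matrix.smul_mul,
    Matrix.add_mul, Matrix.mul_one, Matrix.one_mul, Matrix.mul_assoc] at e ⊢
  rw [← e]
  module

theorem leftReflection_eq (hlam : (lam : ℂ) ∉ spectrum ℂ α)
    (hθ : (lam : ℂ) ∉ spectrum ℂ (theta α S₀ γ₁)) :
    -(Complex.I • (γᴴ * S₀⁻¹ * res lam α * γ₁)) *
        (1 - Complex.I • (γ₁ᴴ * S₀⁻¹ * res lam (theta α S₀ γ₁) * γ₁)) =
      -(Complex.I • (γᴴ * S₀⁻¹ * res lam (theta α S₀ γ₁) * γ₁)) := by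
  have e := congrArg (fun M => γᴴ * S₀⁻¹ * M * γ₁) (res_sub_res_theta hlam hθ)
  simp only [Matrix.mul_sub, Matrix.sub_mul, Matrix.mul_smul, Matrix.smul_mul,
    Matrix.neg_mul, Matrix.mul_one, Matrix.mul_assoc] at e ⊢
  rw [← e]
  module

/-- The solution is the fundamental one times `[I; 0]`. For real `λ` no component decays, so an
admissible constant has lower block in the kernel of `D`; invertibility of `D` is what makes `Y`
unique off the singular set. -/
theorem hasLeftCoefficients (hv : DeterminedBy v α S₀ γ₁ γ) (hS₀ : S₀.det ≠ 0)
    (hlam : (lam : ℂ) ∉ spectrum ℂ α)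
    (hκ : Tendsto (fun x => (RMat α S₀ γ₁ γ x)⁻¹) atTop (𝓝 κ))
    (hD : (1 - Complex.I • (γᴴ * (κ * (res lam α * γ)))).det ≠ 0) :
    HasLeftCoefficients v (singularSet α S₀ γ₁ γ) lam
      (1 - Complex.I • (γ₁ᴴ * S₀⁻¹ * res lam (theta α S₀ γ₁) * γ₁))
      (-(Complex.I • (γᴴ * S₀⁻¹ * res lam (theta α S₀ γ₁) * γ₁))) := by
  have h := hv.admissible
  have hθ := notMem_spectrum_theta h hS₀ hlam
  have hw := tendsto_darboux (lam := lam) h hκ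
  constructor
  · refine ⟨fun x => fundamental α S₀ γ₁ γ lam x * Matrix.fromRows 1 0,
      isSolution_fundamental_mul hv hlam _, ?_⟩
    have := tendsto_fundamental_mul (lam := lam) hw
      (Matrix.fromRows (1 : Matrix (Fin m₁) (Fin m₁) ℂ) 0)
    rw [Matrix.toRows₁_fromRows, Matrix.toRows₂_fromRows, Matrix.mul_zero] at this
    exact tendsto_sub_free_iff.2 this
  · intro Y hY
    set C := (darboux α S₀ γ₁ γ lam 0)⁻¹ * Y 0 with hC
    have hev : ∀ᶠ x in atTop, fundamental α S₀ γ₁ γ lam x * C = Y x := by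
      filter_upwards [eventually_qf_RMat_nonneg h, eventually_ge_atTop 0] with x hx hx0
      exact (hY.solution.eq_fundamental_mul hv hS₀ hlam hx0 ((det_RMat_ne_zero_iff x).1 hx.1)).symm
    have h1 := tendsto_fundamental_mul (lam := lam) hw C
    have h2 := tendsto_sub_free_iff.1 hY.asymptotics
    have hC1 : C.toRows₁ = 1 := by
      refine tendsto_nhds_unique (h1.1.congr' ?_) h2.1
      filter_upwards [hev] with x hx
      rw [← hx, fundamental]
    have hC2 : C.toRows₂ = 0 := by
      have h3 : (1 - Complex.I • (γᴴ * (κ * (res lam α * γ)))) * C.toRows₂ = 0 := by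
        refine tendsto_nhds_unique (h1.2.congr' ?_) h2.2
        filter_upwards [hev] with x hx
        rw [← hx, fundamental]
      have hu := isUnit_iff_ne_zero.2 hD
      rw [← Matrix.one_mul C.toRows₂, ← Matrix.nonsing_inv_mul _ hu, Matrix.mul_assoc, h3,
        Matrix.mul_zero]
    have hY0 : Y 0 = darboux α S₀ γ₁ γ lam 0 * C := by
      rw [hC, ← Matrix.mul_assoc, Matrix.mul_nonsing_inv _ (isUnit_iff_ne_zero.2
        (det_darboux_ne_zero h hlam (by rwa [SMat_zero]))), Matrix.one_mul]
    rw [← Matrix.fromRows_toRows C, hC1, hC2, darboux_zero, Matrix.fromBlocks_mul_fromRows] at hY0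
    simp only [Matrix.mul_one, Matrix.mul_zero, add_zero] at hY0
    rw [hY0, Matrix.toRows₁_fromRows, Matrix.toRows₂_fromRows, inv_leftBlock hlam hθ,
      leftReflection_eq hlam hθ]
    refine ⟨?_, rfl, rfl⟩
    rw [Matrix.isUnit_iff_isUnit_det, isUnit_iff_ne_zero]
    exact (blocks_darboux_zero h hS₀ hlam).1

/-- Pass to the limit in `w^* j w = j`: the off-diagonal blocks of the limit vanish, so the lower
right one is unitary. -/
theorem conjTranspose_mul_limit_eq_one (h : Admissible α S₀ γ₁ γ)
    (hlam : (lam : ℂ) ∉ spectrum ℂ α)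
    (hκ : Tendsto (fun x => (RMat α S₀ γ₁ γ x)⁻¹) atTop (𝓝 κ)) :
    (1 - Complex.I • (γᴴ * (κ * (res lam α * γ))))ᴴ *
      (1 - Complex.I • (γᴴ * (κ * (res lam α * γ)))) = 1 := by
  have hw := tendsto_darboux (lam := lam) h hκ
  have h1 := tendsto_matrix_mul (tendsto_matrix_conjTranspose hw)
    (tendsto_matrix_mul (tendsto_const_nhds (x := jMat m₁ m₂)) hw)
  have h2 := tendsto_nhds_unique (h1.congr' (f₂ := fun _ => jMat m₁ m₂) (by
    filter_upwards [eventually_qf_RMat_nonneg h] with x hx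
    exact darboux_conjTranspose_mul_jMat_mul h hlam ((det_RMat_ne_zero_iff x).1 hx.1)))
    tendsto_const_nhds
  simpa using (blocks_of_conjTranspose_mul_jMat_mul h2).2

/-- The relation `α^* S₀⁻¹ = S₀⁻¹ θ + i S₀⁻¹ γγ^* S₀⁻¹` trades the resolvent of `θ` for that of
`α^*`. After applying `(λ - α^*)⁻¹`, multiplication by `γ^*` and by `γ₁^*` yields the transmission
and the reflection formula respectively. -/
theorem inv_mul_gamma_mul_rightTransmission (h : Admissible α S₀ γ₁ γ) (hS₀ : S₀.det ≠ 0)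
    (hθ : (lam : ℂ) ∉ spectrum ℂ (theta α S₀ γ₁)) :
    S₀⁻¹ * (γ * (1 - Complex.I •
        (γᴴ * S₀⁻¹ * res lam (theta α S₀ γ₁) * (1 - S₀ * κ) * γ))) =
      ((lam : ℂ) • 1 - αᴴ) * (S₀⁻¹ * res lam (theta α S₀ γ₁) * (1 - S₀ * κ) * γ) + κ * γ := by
  have hu := isUnit_iff_ne_zero.2 hS₀
  set X := S₀⁻¹ * res lam (theta α S₀ γ₁) * (1 - S₀ * κ) * γ with hX
  have hβ : αᴴ * S₀⁻¹ = S₀⁻¹ * theta α S₀ γ₁ + Complex.I • (S₀⁻¹ * (γ * (γᴴ * S₀⁻¹))) := by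
    have e : S₀⁻¹ * (α * S₀ - S₀ * αᴴ) * S₀⁻¹ = S₀⁻¹ * α - αᴴ * S₀⁻¹ := by
      rw [Matrix.mul_sub, Matrix.sub_mul, Matrix.mul_assoc, Matrix.mul_assoc,
        Matrix.mul_nonsing_inv _ hu, Matrix.mul_one, ← Matrix.mul_assoc S₀⁻¹ S₀,
        Matrix.nonsing_inv_mul _ hu, Matrix.one_mul]
    rw [h.identity] at e
    have e' : αᴴ * S₀⁻¹ = S₀⁻¹ * α -
        S₀⁻¹ * (Complex.I • (γ₁ * γ₁ᴴ - γ * γᴴ)) * S₀⁻¹ := by rw [e]; abel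
    rw [e', theta]
    simp only [Matrix.mul_sub, Matrix.sub_mul, Matrix.mul_smul, Matrix.smul_mul, smul_sub,
      Matrix.mul_assoc]
    abel
  have hβX : αᴴ * X = S₀⁻¹ * (theta α S₀ γ₁ * (res lam (theta α S₀ γ₁) * ((1 - S₀ * κ) * γ))) +
      Complex.I • (S₀⁻¹ * (γ * (γᴴ * X))) := by
    have := congrArg (· * (res lam (theta α S₀ γ₁) * ((1 - S₀ * κ) * γ))) hβ
    simpa only [hX, Matrix.mul_assoc, Matrix.add_mul, Matrix.smul_mul] using this
  have hθX : theta α S₀ γ₁ * (res lam (theta α S₀ γ₁) * ((1 - S₀ * κ) * γ)) =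
      (lam : ℂ) • (res lam (theta α S₀ γ₁) * ((1 - S₀ * κ) * γ)) - (1 - S₀ * κ) * γ := by
    rw [← Matrix.mul_assoc, mul_res_eq hθ, Matrix.sub_mul, Matrix.smul_mul, Matrix.one_mul]
  have hκγ : S₀⁻¹ * ((1 - S₀ * κ) * γ) = S₀⁻¹ * γ - κ * γ := by
    rw [← Matrix.mul_assoc, Matrix.mul_sub, Matrix.mul_one, ← Matrix.mul_assoc,
      Matrix.nonsing_inv_mul _ hu, Matrix.one_mul, Matrix.sub_mul]
  have hγX : γᴴ * S₀⁻¹ * res lam (theta α S₀ γ₁) * (1 - S₀ * κ) * γ = γᴴ * X := by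
    simp only [hX, Matrix.mul_assoc]
  have hX' : S₀⁻¹ * (res lam (theta α S₀ γ₁) * ((1 - S₀ * κ) * γ)) = X := by
    simp only [hX, Matrix.mul_assoc]
  rw [hγX, Matrix.sub_mul, hβX, hθX, Matrix.mul_sub S₀⁻¹, Matrix.mul_smul, hX', hκγ, Matrix.smul_mul,
    Matrix.one_mul]
  simp only [Matrix.mul_sub, Matrix.mul_smul, Matrix.mul_one]
  abel

theorem hasRightCoefficients (hv : DeterminedBy v α S₀ γ₁ γ) (hS₀ : S₀.det ≠ 0)
    (hlam : (lam : ℂ) ∉ spectrum ℂ α)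
    (hκ : Tendsto (fun x => (RMat α S₀ γ₁ γ x)⁻¹) atTop (𝓝 κ)) :
    HasRightCoefficients v (singularSet α S₀ γ₁ γ) lam
      (1 - Complex.I • (γᴴ * S₀⁻¹ * res lam (theta α S₀ γ₁) * (1 - S₀ * κ) * γ))
      (-(Complex.I • (γ₁ᴴ * S₀⁻¹ * res lam (theta α S₀ γ₁) * (1 - S₀ * κ) * γ)) -
        Complex.I • (γ₁ᴴ * res lam αᴴ * κ * γ)) := by
  have h := hv.admissible
  have hθ := notMem_spectrum_theta h hS₀ hlam
  have hα' := notMem_spectrum_conjTranspose hlam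
  have hdw := det_darboux_ne_zero h hlam (x := 0) (by rwa [SMat_zero])
  constructor
  · have hE : ∀ B : Matrix (Fin m₁ ⊕ Fin m₂) (Fin m₂) ℂ,
        fundamental α S₀ γ₁ γ lam 0 * ((darboux α S₀ γ₁ γ lam 0)⁻¹ * B) = B := fun B => by
      rw [fundamental, phase_zero, Matrix.mul_one, ← Matrix.mul_assoc,
        Matrix.mul_nonsing_inv _ (isUnit_iff_ne_zero.2 hdw), Matrix.one_mul]
    exact ⟨_, isSolution_fundamental_mul hv hlam _, hE _⟩
  · intro Z hZ
    have hinv : (darboux α S₀ γ₁ γ lam 0)⁻¹ =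
        jMat m₁ m₂ * (darboux α S₀ γ₁ γ lam 0)ᴴ * jMat m₁ m₂ := by
      refine Matrix.inv_eq_left_inv ?_
      rw [Matrix.mul_assoc, Matrix.mul_assoc,
        darboux_conjTranspose_mul_jMat_mul h hlam (by rwa [SMat_zero]), jMat_mul_self]
    set D := 1 - Complex.I • (γᴴ * (κ * (res lam α * γ))) with hD
    set c := -(Complex.I • (γᴴ * S₀⁻¹ * res lam α * γ₁)) with hc
    set d := 1 - Complex.I • (γᴴ * S₀⁻¹ * res lam α * γ) with hd
    -- With `w⁻¹ = j w^* j`, the constant for `Z` is read off from the adjoint of the lower block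
    -- row `[c, d]` of `w(0)`, without inverting blocks.
    have hC : (darboux α S₀ γ₁ γ lam 0)⁻¹ * Z 0 = Matrix.fromRows (-cᴴ) dᴴ := by
      rw [hinv, hZ.initial, darboux_zero, Matrix.fromBlocks_conjTranspose, jMat,
        Matrix.fromBlocks_multiply, Matrix.fromBlocks_multiply, Matrix.fromBlocks_mul_fromRows]
      simp only [Matrix.one_mul, Matrix.zero_mul, Matrix.mul_zero, add_zero, zero_add,
        Matrix.neg_mul, Matrix.mul_neg, Matrix.mul_one, neg_neg]
      rw [hc, hd]
    have hev : ∀ᶠ x in atTop, fundamental α S₀ γ₁ γ lam x * Matrix.fromRows (-cᴴ) dᴴ = Z x := by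
      filter_upwards [eventually_qf_RMat_nonneg h, eventually_ge_atTop 0] with x hx hx0
      rw [← hC]
      exact (hZ.solution.eq_fundamental_mul hv hS₀ hlam hx0 ((det_RMat_ne_zero_iff x).1 hx.1)).symm
    have hlim := tendsto_fundamental_mul (lam := lam) (tendsto_darboux (lam := lam) h hκ)
      (Matrix.fromRows (-cᴴ) dᴴ)
    rw [Matrix.toRows₁_fromRows, Matrix.toRows₂_fromRows] at hlim
    have hDD : D * Dᴴ = 1 := mul_eq_one_comm.1 (conjTranspose_mul_limit_eq_one h hlam hκ)
    have hS₀H : S₀⁻¹ᴴ = S₀⁻¹ := h.hermitian.inv.eq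
    have hκH : κᴴ = κ := tendsto_nhds_unique
      ((tendsto_matrix_conjTranspose hκ).congr fun x => (RMat_isHermitian h.hermitian x).inv.eq) hκ
    have key := inv_mul_gamma_mul_rightTransmission (κ := κ) h hS₀ hθ
    set X := S₀⁻¹ * res lam (theta α S₀ γ₁) * (1 - S₀ * κ) * γ with hX
    have hγX : γᴴ * S₀⁻¹ * res lam (theta α S₀ γ₁) * (1 - S₀ * κ) * γ = γᴴ * X := by
      simp only [hX, Matrix.mul_assoc]
    have hγX₁ : γ₁ᴴ * S₀⁻¹ * res lam (theta α S₀ γ₁) * (1 - S₀ * κ) * γ = γ₁ᴴ * X := by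
      simp only [hX, Matrix.mul_assoc]
    rw [hγX] at key ⊢
    rw [hγX₁]
    have key' : res lam αᴴ * (S₀⁻¹ * (γ * (1 - Complex.I • (γᴴ * X)))) =
        X + res lam αᴴ * (κ * γ) := by
      rw [key, Matrix.mul_add, ← Matrix.mul_assoc, res_mul hα', Matrix.one_mul]
    have hdT : dᴴ * (1 - Complex.I • (γᴴ * X)) = Dᴴ := by
      have e1 : dᴴ = 1 + Complex.I • (γᴴ * (res lam αᴴ * (S₀⁻¹ * γ))) := by
        simp only [hd, Matrix.conjTranspose_sub, Matrix.conjTranspose_one, Matrix.conjTranspose_smul,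
          Matrix.conjTranspose_mul, Matrix.conjTranspose_conjTranspose, hS₀H, res_conjTranspose,
          Complex.star_def, Complex.conj_I, neg_smul, sub_neg_eq_add]
      have e2 : Dᴴ = 1 + Complex.I • (γᴴ * (res lam αᴴ * (κ * γ))) := by
        simp only [hD, Matrix.conjTranspose_sub, Matrix.conjTranspose_one, Matrix.conjTranspose_smul,
          Matrix.conjTranspose_mul, Matrix.conjTranspose_conjTranspose, hκH, res_conjTranspose,
          Complex.star_def, Complex.conj_I, neg_smul, sub_neg_eq_add, Matrix.mul_assoc]
      have e3 := congrArg (γᴴ * ·) key'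
      simp only [Matrix.mul_add] at e3
      rw [e1, e2, Matrix.add_mul, Matrix.one_mul, Matrix.smul_mul]
      simp only [Matrix.mul_assoc]
      rw [e3]
      module
    -- The limit of the lower block is `D d^*`; as `d^*` times the claimed `T_R` equals `D^*`,
    -- unitarity of `D` identifies `T_R` as its inverse.
    have hBT : D * dᴴ * (1 - Complex.I • (γᴴ * X)) = 1 := by rw [Matrix.mul_assoc, hdT, hDD]
    have hTinv : (D * dᴴ)⁻¹ = 1 - Complex.I • (γᴴ * X) := Matrix.inv_eq_right_inv hBT
    refine ⟨-cᴴ, D * dᴴ, hlim.1.congr' ?_, hlim.2.congr' ?_, ?_, hTinv.symm, ?_⟩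
    · filter_upwards [hev] with x hx
      rw [← hx, fundamental]
    · filter_upwards [hev] with x hx
      rw [← hx, fundamental]
    · exact IsUnit.of_mul_eq_one _ hBT
    · have e1 : cᴴ = Complex.I • (γ₁ᴴ * (res lam αᴴ * (S₀⁻¹ * γ))) := by
        simp only [hc, Matrix.conjTranspose_neg, Matrix.conjTranspose_smul,
          Matrix.conjTranspose_mul, Matrix.conjTranspose_conjTranspose, hS₀H, res_conjTranspose,
          Complex.star_def, Complex.conj_I, neg_smul, neg_neg]
      have e3 := congrArg (γ₁ᴴ * ·) key'
      simp only [Matrix.mul_add] at e3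
      rw [hTinv, e1, Matrix.neg_mul, Matrix.smul_mul]
      simp only [Matrix.mul_assoc]
      rw [e3]
      module

end Scattering

end DiracPE

end

/-! ### The theorem. -/

theorem theorem2p2 {n m₁ m₂ : ℕ}
    (v : ℝ → Matrix (Fin m₁) (Fin m₂) ℂ)
    (α S₀ : Matrix (Fin n) (Fin n) ℂ)
    (γ₁ : Matrix (Fin n) (Fin m₁) ℂ) (γ : Matrix (Fin n) (Fin m₂) ℂ)
    (hv : DiracPE.DeterminedBy v α S₀ γ₁ γ) (hS₀ : S₀.det ≠ 0) :
    ∃ κ : Matrix (Fin n) (Fin n) ℂ,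
      (∀ᶠ x : ℝ in atTop, IsUnit (DiracPE.RMat α S₀ γ₁ γ x)) ∧
      Tendsto (fun x : ℝ => (DiracPE.RMat α S₀ γ₁ γ x)⁻¹) atTop (𝓝 κ) ∧
      ∀ lam : ℝ, (lam : ℂ) ∉ spectrum ℂ α →
        (lam : ℂ) ∉ spectrum ℂ (DiracPE.theta α S₀ γ₁) ∧
        (lam : ℂ) ∉ spectrum ℂ αᴴ ∧
        DiracPE.HasLeftCoefficients v (DiracPE.singularSet α S₀ γ₁ γ) lam
          (1 - Complex.I • (γ₁ᴴ * S₀⁻¹ * DiracPE.res lam (DiracPE.theta α S₀ γ₁) * γ₁))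
          (-(Complex.I • (γᴴ * S₀⁻¹ * DiracPE.res lam (DiracPE.theta α S₀ γ₁) * γ₁))) ∧
        DiracPE.HasRightCoefficients v (DiracPE.singularSet α S₀ γ₁ γ) lam
          (1 - Complex.I •
            (γᴴ * S₀⁻¹ * DiracPE.res lam (DiracPE.theta α S₀ γ₁) * (1 - S₀ * κ) * γ))
          (-(Complex.I •
              (γ₁ᴴ * S₀⁻¹ * DiracPE.res lam (DiracPE.theta α S₀ γ₁) * (1 - S₀ * κ) * γ)) -
            Complex.I • (γ₁ᴴ * DiracPE.res lam αᴴ * κ * γ)) := by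
  have h := hv.admissible
  obtain ⟨κ, hκ⟩ := DiracPE.exists_tendsto_inv_RMat h
  refine ⟨κ, ?_, hκ, fun lam hlam => ⟨DiracPE.notMem_spectrum_theta h hS₀ hlam,
    DiracPE.notMem_spectrum_conjTranspose hlam, ?_, DiracPE.hasRightCoefficients hv hS₀ hlam hκ⟩⟩
  · filter_upwards [DiracPE.eventually_qf_RMat_nonneg h] with x hx
    exact (Matrix.isUnit_iff_isUnit_det _).2 (isUnit_iff_ne_zero.2 hx.1)
  · exact DiracPE.hasLeftCoefficients hv hS₀ hlam hκ
      (Matrix.det_ne_zero_of_left_inverse (DiracPE.conjTranspose_mul_limit_eq_one h hlam hκ))
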